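/- Let $\pi$ be a set of primes, let $\pi'$ be the set of all primes not in $\pi$, and let $G$ be a finite group which is $\pi$-soluble, i.e. has a series $1=G_0\lhd G_1\lhd\cdots\lhd G_m=G$ such that each factor $G_i/G_{i-1}$ is either a $p$-group for some $p\in\pi$ or a $\pi'$-group (a finite group is a $\pi$-group if all prime divisors of its order lie in $\pi$). For a class $\mathfrak F$ of groups, a subgroup $V$ of a group $X$ is called $\mathfrak F$-maximal in $X$ if $V\in\mathfrak F$ and $U=V$ whenever $V\le U\le X$ and $U\in\mathfrak F$; and $V\le X$ is an $\mathfrak F$-injector of $X$ if $V\cap K$ is an $\mathfrak F$-maximal subgroup of $K$ for every subnormal subgroup $K$ of $X$. Let $\mathfrak N_\pi$ be the class of finite nilpotent $\pi$-groups and $\mathfrak N^\pi$ the class of finite $\pi$-nilpotent groups, i.e. finite groups which for every $p\in\pi$ have a normal Hall $p'$-subgroup. Here a Hall $\pi$-subgroup of a finite group $X$ is a $\pi$-subgroup $H$ with all prime divisors of $|X:H|$ in $\pi'$, and $p'=\{p\}'$. Let $O_{\pi'}(G)$ be the largest normal $\pi'$-subgroup of $G$. Then: 1. The $\mathfrak N^\pi$-injectors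 of $G$ form exactly one conjugacy class of subgroups of $G$. 2. For every $\mathfrak N^\pi$-injector $V$ of $G$ there are a Hall $\pi$-subgroup $H$ of $G$ and an $\mathfrak N_\pi$-injector $L$ of $H$ such that $V=O_{\pi'}(G)\,L$. -/

import Mathlib

open scoped Pointwise

universe u

/-- `σ(G)`: the set of all primes dividing the order of the (finite) group `G`. -/
def sigma (G : Type u) [Group G] : Set Nat.Primes :=
  {p | (p : ℕ) ∣ Nat.card G}

/-- A (finite) group `G` is a `π`-group if `σ(G) ⊆ π`. For a set `π` of primes, `π'` is the
complement `πᶜ` in the set of all primes. -/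
def IsPiGroup (π : Set Nat.Primes) (G : Type u) [Group G] : Prop :=
  sigma G ⊆ π

/-- `H` is a Hall `π`-subgroup of `G`: `H` is a `π`-group and every prime divisor of `|G : H|`
lies in `π'`. -/
def IsHallSubgroup (π : Set Nat.Primes) {G : Type u} [Group G] (H : Subgroup G) : Prop :=
  IsPiGroup π H ∧ {p : Nat.Primes | (p : ℕ) ∣ H.index} ⊆ πᶜ

/-- `G` is `p`-nilpotent if it has a normal Hall `p'`-subgroup. -/
def IsPNilpotent (p : Nat.Primes) (G : Type u) [Group G] : Prop :=
  ∃ N : Subgroup G, N.Normal ∧ IsHallSubgroup {p}ᶜ N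

/-- `G` is `π`-soluble if it has a series `1 = S 0 ◁ S 1 ◁ ⋯ ◁ S m = G` each of whose factors is
either a `p`-group for some `p ∈ π` or a `π'`-group. -/
def IsPiSoluble (π : Set Nat.Primes) (G : Type u) [Group G] : Prop :=
  ∃ (m : ℕ) (S : ℕ → Subgroup G), S 0 = ⊥ ∧ S m = ⊤ ∧
    ∀ i < m, S i ≤ S (i + 1) ∧
      ∃ _ : ((S i).subgroupOf (S (i + 1))).Normal,
        (∃ p ∈ π, IsPGroup (p : ℕ) (↥(S (i + 1)) ⧸ (S i).subgroupOf (S (i + 1)))) ∨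
          IsPiGroup πᶜ (↥(S (i + 1)) ⧸ (S i).subgroupOf (S (i + 1)))

/-- The `π`-radical `O_π(G)`, generated by all normal `π`-subgroups of `G`; for finite `G` this is
the largest normal `π`-subgroup. -/
def piRadical (π : Set Nat.Primes) (G : Type u) [Group G] : Subgroup G :=
  sSup {N : Subgroup G | N.Normal ∧ IsPiGroup π N}

/-- A class of groups, given by its membership predicate. -/
abbrev GroupClass : Type (u + 1) := ∀ (H : Type u) [Group H], Prop

/-- The class `𝔑^π` of `π`-nilpotent groups: the groups that are `p`-nilpotent for all `p ∈ π`. -/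
def PiNilpotent (π : Set Nat.Primes) : GroupClass.{u} :=
  fun H _ => ∀ p ∈ π, IsPNilpotent p H

/-- The class `𝔑_π` of nilpotent `π`-groups. -/
def NilpotentPi (π : Set Nat.Primes) : GroupClass.{u} :=
  fun H _ => Group.IsNilpotent H ∧ IsPiGroup π H

/-- `V` is an `𝔉`-maximal subgroup of `G`: `V ∈ 𝔉`, and `U = V` whenever `V ≤ U ≤ G`, `U ∈ 𝔉`. -/
def IsClassMaximal (F : GroupClass.{u}) {G : Type u} [Group G] (V : Subgroup G) : Prop :=
  F V ∧ ∀ U : Subgroup G, V ≤ U → F U → U = V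

/-- `V` is an `𝔉`-injector of `G`: for every subnormal subgroup `K` of `G`, the intersection
`V ∩ K`, viewed as a subgroup of `K`, is an `𝔉`-maximal subgroup of `K`. -/
def IsInjector (F : GroupClass.{u}) {G : Type u} [Group G] (V : Subgroup G) : Prop :=
  ∀ K : Subgroup G, K.IsSubnormal → IsClassMaximal F (V.subgroupOf K)

/-! Put R = O_{π'}(G). Since O_{π'}(G/R) = 1, π-solubility gives G/R a normal nilpotent π-subgroup F
containing its centralizer (`HasPiSeries.exists_centralizer_le`). For each prime p let C_p be the
centralizer of the p'-elements of F and P_p a Sylow p-subgroup of C_p (Mann's construction). For p ≠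
q, C_p ∩ C_q ≤ C(F) ≤ F, whence C_q normalizes P_p (`IsMannFamily.conj_mem`). So the P_p commute
pairwise, their product M is nilpotent and contains F, and Sylow conjugacy, applied one prime at a
time, makes all such M conjugate (`IsMannFamily.exists_conj`).

The injectors of G are exactly the preimages of the groups M. A π-nilpotent U with M ∩ K ≤ U ≤ K, K
subnormal, is nilpotent and lies in M, because coprime centralization passes from F ∩ K to F
(`IsMannFamily.le_of_subnormal`). Conversely, an injector contains the preimage of F, so its image
is nilpotent, and every nilpotent overgroup of F lies in some M.

A Hall π-subgroup H embeds in G/R. Up to conjugacy its image contains all the P_p; pulled back to H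
they form the same construction there, with product L an injector of H, and the preimage of M is RL.
-/

/-! ### π-groups and radicals. -/

section PiGroups

variable {π ρ : Set Nat.Primes}

theorem IsPiGroup.of_card_dvd {H K : Type u} [Group H] [Group K] (hK : IsPiGroup π K)
    (h : Nat.card H ∣ Nat.card K) : IsPiGroup π H :=
  fun _ hp => hK (dvd_trans hp h)

theorem IsPiGroup.of_card_dvd_mul {H K L : Type u} [Group H] [Group K] [Group L]
    (hK : IsPiGroup π K) (hL : IsPiGroup π L) (h : Nat.card H ∣ Nat.card K * Nat.card L) :
    IsPiGroup π H := by
  intro p hp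
  rcases (p.2.dvd_mul).1 (dvd_trans hp h) with h' | h'
  exacts [hK h', hL h']

theorem IsPiGroup.mono_subgroup {X : Type u} [Group X] [Finite X] {H K : Subgroup X} (hHK : H ≤ K)
    (hK : IsPiGroup π K) : IsPiGroup π H :=
  hK.of_card_dvd (Subgroup.card_dvd_of_le hHK)

theorem IsPiGroup.subgroup {X : Type u} [Group X] [Finite X] (hX : IsPiGroup π X)
    (H : Subgroup X) : IsPiGroup π H :=
  hX.of_card_dvd (Subgroup.card_subgroup_dvd_card H)

theorem IsPiGroup.map {X Y : Type u} [Group X] [Group Y] {H : Subgroup X} (hH : IsPiGroup π H)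
    (f : X →* Y) : IsPiGroup π (H.map f) :=
  hH.of_card_dvd (Subgroup.card_map_dvd H f)

theorem isPiGroup_bot {X : Type u} [Group X] : IsPiGroup π (⊥ : Subgroup X) := by
  intro p hp
  have : (p : ℕ) ∣ 1 := by simpa [sigma] using hp
  exact absurd (Nat.dvd_one.1 this) p.2.one_lt.ne'

theorem IsPiGroup.mem_of_dvd_orderOf {X : Type u} [Group X] {H : Subgroup X} (hH : IsPiGroup π H)
    {x : X} (hx : x ∈ H) (p : Nat.Primes) (hp : (p : ℕ) ∣ orderOf x) : p ∈ π :=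
  hH (dvd_trans hp (by
    have := orderOf_dvd_natCard (⟨x, hx⟩ : H)
    rwa [Subgroup.orderOf_mk] at this))

theorem IsPiGroup.coprime_card {H K : Type u} [Group H] [Group K] (hH : IsPiGroup π H)
    (hK : IsPiGroup πᶜ K) : (Nat.card H).Coprime (Nat.card K) := by
  refine Nat.coprime_of_dvd fun p hp h1 h2 => ?_
  exact hK (show (⟨p, hp⟩ : Nat.Primes) ∈ sigma K from h2) (hH (show ⟨p, hp⟩ ∈ sigma H from h1))

theorem IsPGroup.isPiGroup {p : Nat.Primes} {H : Type u} [Group H] [Finite H]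
    (h : IsPGroup (p : ℕ) H) : IsPiGroup {p} H := by
  have : Fact (p : ℕ).Prime := ⟨p.2⟩
  obtain ⟨n, hn⟩ := IsPGroup.iff_card.1 h
  intro q hq
  have hq' : (q : ℕ) ∣ (p : ℕ) ^ n := hn ▸ hq
  exact Nat.Primes.coe_nat_injective ((Nat.prime_dvd_prime_iff_eq q.2 p.2).1
    (q.2.dvd_of_dvd_pow hq'))

theorem IsPiGroup.isPGroup {p : Nat.Primes} {H : Type u} [Group H] [Finite H]
    (h : IsPiGroup {p} H) : IsPGroup (p : ℕ) H := by
  refine IsPGroup.of_card (Nat.eq_prime_pow_of_unique_prime_dvd (n := Nat.card H)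
    Nat.card_pos.ne' fun {q} hq hd => ?_)
  exact congrArg Subtype.val (h (show (⟨q, hq⟩ : Nat.Primes) ∈ sigma H from hd))

theorem card_sup_dvd_of_le_normalizer {X : Type u} [Group X] (H N : Subgroup X)
    (h : H ≤ Subgroup.normalizer (N : Set X)) :
    Nat.card (H ⊔ N : Subgroup X) ∣ Nat.card H * Nat.card N := by
  have h1 : N.relIndex H = N.relIndex (H ⊔ N) := by
    have := Subgroup.normal_subgroupOf_of_le_normalizer h
    have := Subgroup.normal_subgroupOf_sup_of_le_normalizer h
    exact Nat.card_congr (QuotientGroup.quotientInfEquivProdNormalizerQuotient H N h).toEquiv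
  have h2 : Nat.card N * N.relIndex (H ⊔ N) = Nat.card (H ⊔ N : Subgroup X) := by
    rw [← Subgroup.relIndex_bot_left, ← Subgroup.relIndex_bot_left]
    exact Subgroup.relIndex_mul_relIndex _ _ _ bot_le le_sup_right
  rw [← h2, ← h1, mul_comm (Nat.card H)]
  exact mul_dvd_mul_left _ (Subgroup.relIndex_dvd_card _ _)

theorem mem_normalizer_of_finite {X : Type u} [Group X] [Finite X] {T : Subgroup X} {g : X}
    (h : ∀ t ∈ T, g * t * g⁻¹ ∈ T) : g ∈ Subgroup.normalizer (T : Set X) :=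
  Subgroup.mem_normalizer_fintype (S := (T : Set X)) h

/-- Every subgroup `H` contains a largest `H`-invariant `ρ`-subgroup. -/
theorem exists_relative_radical (ρ : Set Nat.Primes) {X : Type u} [Group X] [Finite X]
    (H : Subgroup X) : ∃ O ≤ H, (∀ h ∈ H, ∀ t ∈ O, h * t * h⁻¹ ∈ O) ∧ IsPiGroup ρ O ∧
      ∀ T ≤ H, (∀ h ∈ H, ∀ t ∈ T, h * t * h⁻¹ ∈ T) → IsPiGroup ρ T → T ≤ O := by
  let S : Set (Subgroup X) := {T | T ≤ H ∧ (∀ h ∈ H, ∀ t ∈ T, h * t * h⁻¹ ∈ T) ∧ IsPiGroup ρ T}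
  have hne : S.Nonempty := ⟨⊥, bot_le, by simp, isPiGroup_bot⟩
  obtain ⟨O, ⟨hO1, hO2, hO3⟩, hmax⟩ := (Set.toFinite S).exists_maximal hne
  refine ⟨O, hO1, hO2, hO3, fun T hT1 hT2 hT3 => ?_⟩
  -- Joins of invariant ρ-subgroups are again such, so a maximal one is the largest.
  have : O ⊔ T ∈ S := by
    refine ⟨sup_le hO1 hT1, fun h hh t ht => ?_, hO3.of_card_dvd_mul hT3
      (card_sup_dvd_of_le_normalizer O T fun x hx => mem_normalizer_of_finite (hT2 x (hO1 hx)))⟩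
    have key : O ⊔ T ≤ (O ⊔ T).comap (MulAut.conj h).toMonoidHom :=
      sup_le (fun x hx => Subgroup.mem_sup_left (hO2 h hh x hx))
        (fun x hx => Subgroup.mem_sup_right (hT2 h hh x hx))
    exact key ht
  exact le_sup_right.trans (hmax this le_sup_left)

theorem exists_radical (ρ : Set Nat.Primes) (X : Type u) [Group X] [Finite X] :
    ∃ O : Subgroup X, O.Normal ∧ IsPiGroup ρ O ∧
      ∀ T : Subgroup X, T.Normal → IsPiGroup ρ T → T ≤ O := by
  obtain ⟨O, -, h1, h2, h3⟩ := exists_relative_radical ρ (⊤ : Subgroup X)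
  exact ⟨O, ⟨fun n hn g => h1 g trivial n hn⟩, h2, fun T hT hT' =>
    h3 T le_top (fun h _ t ht => hT.conj_mem t ht h) hT'⟩

theorem le_piRadical {X : Type u} [Group X] {T : Subgroup X} (hT : T.Normal)
    (h : IsPiGroup ρ T) : T ≤ piRadical ρ X :=
  le_sSup ⟨hT, h⟩

theorem piRadical_normal (ρ : Set Nat.Primes) (X : Type u) [Group X] [Finite X] :
    (piRadical ρ X).Normal := by
  obtain ⟨O, h1, h2, h3⟩ := exists_radical ρ X
  have : piRadical ρ X = O := le_antisymm (sSup_le fun T hT => h3 T hT.1 hT.2) (le_piRadical h1 h2)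
  rwa [this]

theorem isPiGroup_piRadical (ρ : Set Nat.Primes) (X : Type u) [Group X] [Finite X] :
    IsPiGroup ρ (piRadical ρ X) := by
  obtain ⟨O, h1, h2, h3⟩ := exists_radical ρ X
  have : piRadical ρ X = O := le_antisymm (sSup_le fun T hT => h3 T hT.1 hT.2) (le_piRadical h1 h2)
  rwa [this]

/-- A subnormal `ρ`-subgroup is contained in the `ρ`-radical. -/
theorem Subgroup.IsSubnormal.le_piRadical {X : Type u} [Group X] [Finite X] {H : Subgroup X}
    (hH : H.IsSubnormal) (hρ : IsPiGroup ρ H) : H ≤ piRadical ρ X := by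
  -- Strengthened to all invariant ρ-subgroups of H so that the induction runs: the largest one is
  -- characteristic in H, hence invariant under the next term K of the chain.
  have key : ∀ T ≤ H, (∀ h ∈ H, ∀ t ∈ T, h * t * h⁻¹ ∈ T) → IsPiGroup ρ T →
      T ≤ piRadical ρ X := by
    clear hρ
    induction hH with
    | top => exact fun T _ h1 h2 => _root_.le_piRadical ⟨fun n hn g => h1 g trivial n hn⟩ h2
    | step H K h_le _ hN ih =>
      intro T hT1 hT2 hT3
      obtain ⟨O, hO1, hO2, hO3, hO4⟩ := exists_relative_radical ρ H
      have hconj : ∀ k ∈ K, ∀ h ∈ H, k * h * k⁻¹ ∈ H := fun k hk h hh =>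
        hN.conj_mem ⟨h, h_le hh⟩ hh ⟨k, hk⟩
      refine (hO4 T hT1 hT2 hT3).trans (ih O (hO1.trans h_le) (fun k hk => ?_) hO3)
      have : O.map (MulAut.conj k).toMonoidHom ≤ O := by
        refine hO4 _ ?_ ?_ (hO3.map _)
        · rintro _ ⟨x, hx, rfl⟩
          exact hconj k hk x (hO1 hx)
        · rintro h hh _ ⟨x, hx, rfl⟩
          refine ⟨k⁻¹ * h * k * x * (k⁻¹ * h * k)⁻¹, hO2 _ ?_ x hx, by simp [mul_assoc]⟩
          simpa using hconj k⁻¹ (inv_mem hk) h hh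
      exact fun t ht => this ⟨t, ht, rfl⟩
  exact key H le_rfl (fun h hh t ht => mul_mem (mul_mem hh ht) (inv_mem hh)) hρ

end PiGroups

/-! ### Elements of prime-power and coprime order. -/

section Elements

variable {X : Type u} [Group X] [Finite X]

/-- The decomposition of an element into its `p`-part and its `p'`-part. -/
theorem exists_primary_decomposition {p : ℕ} (hp : p.Prime) (z : X) :
    ∃ a ∈ Subgroup.zpowers z, ∃ b ∈ Subgroup.zpowers z,
      z = a * b ∧ (∃ k, orderOf a = p ^ k) ∧ (orderOf b).Coprime p := by
  have hn : orderOf z ≠ 0 := (orderOf_pos z).ne'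
  obtain ⟨k, m, hm, hk⟩ := Nat.exists_eq_pow_mul_and_not_dvd hn p hp.ne_one
  have hm0 : 0 < m := Nat.pos_of_ne_zero fun h => hm (h ▸ dvd_zero p)
  have hpk : 0 < p ^ k := pow_pos hp.pos k
  have hcop : Nat.Coprime m (p ^ k) := ((Nat.Prime.coprime_iff_not_dvd hp).2 hm).symm.pow_right k
  have hbez := Nat.gcd_eq_gcd_ab m (p ^ k)
  rw [hcop.gcd_eq_one] at hbez
  set s := Nat.gcdA m (p ^ k)
  set t := Nat.gcdB m (p ^ k)
  refine ⟨(z ^ m) ^ s, ⟨m * s, by simp [zpow_mul]⟩, (z ^ p ^ k) ^ t,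
    ⟨(p ^ k : ℕ) * t, (zpow_mul z _ t).trans (by norm_cast)⟩, ?_, ?_, ?_⟩
  · have : z ^ (1 : ℤ) = z ^ ((m : ℤ) * s + ((p ^ k : ℕ) : ℤ) * t) := by rw [← hbez]; norm_cast
    rw [zpow_one, zpow_add, zpow_mul, zpow_mul] at this
    exact_mod_cast this
  · have h1 : orderOf (z ^ m) = p ^ k := by
      rw [orderOf_pow_of_dvd hm0.ne' (hk ▸ dvd_mul_left m _), hk, Nat.mul_div_cancel _ hm0]
    obtain ⟨j, -, hj⟩ := (Nat.dvd_prime_pow hp).1 (h1 ▸ orderOf_dvd_of_mem_zpowers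
      (Subgroup.zpow_mem_zpowers (z ^ m) s))
    exact ⟨j, hj⟩
  · have h1 : orderOf (z ^ p ^ k) = m := by
      rw [orderOf_pow_of_dvd hpk.ne' (hk ▸ dvd_mul_right _ m), hk, Nat.mul_div_cancel_left _ hpk]
    exact Nat.Coprime.coprime_dvd_left (h1 ▸ orderOf_dvd_of_mem_zpowers
      (Subgroup.zpow_mem_zpowers (z ^ p ^ k) t)) ((Nat.Prime.coprime_iff_not_dvd hp).2 hm).symm

/-- A subgroup containing, for every prime, a Sylow subgroup of `U` contains `U`. -/
theorem le_of_forall_sylow_le {U S : Subgroup X}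
    (h : ∀ p, p.Prime → ∃ P : Sylow p U, (P : Subgroup U).map U.subtype ≤ S) : U ≤ S := by
  rw [← Subgroup.relIndex_eq_one]
  refine Nat.eq_one_iff_not_exists_prime_dvd.2 fun p hp hd => ?_
  have : Fact p.Prime := ⟨hp⟩
  obtain ⟨P, hP⟩ := h p hp
  exact P.not_dvd_index (hd.trans (Subgroup.index_dvd_of_le (Subgroup.map_le_iff_le_comap.1 hP)))

theorem le_of_forall_primary_mem {U S : Subgroup X}
    (h : ∀ p, p.Prime → ∀ x ∈ U, (∃ k, orderOf x = p ^ k) → x ∈ S) : U ≤ S := by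
  refine le_of_forall_sylow_le fun p hp => ⟨default, ?_⟩
  have : Fact p.Prime := ⟨hp⟩
  rintro _ ⟨x, hx, rfl⟩
  refine h p hp _ x.2 ?_
  obtain ⟨k, hk⟩ := IsPGroup.iff_orderOf.1 (default : Sylow p U).isPGroup' ⟨x, hx⟩
  exact ⟨k, by simpa using hk⟩

theorem mem_sylow_of_normal {p : ℕ} (hp : p.Prime) (Q : Sylow p X) [(Q : Subgroup X).Normal]
    {x : X} (hx : ∃ k, orderOf x = p ^ k) : x ∈ Q := by
  obtain ⟨k, hk⟩ := hx
  have : Fact p.Prime := ⟨hp⟩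
  have hP : IsPGroup p (Subgroup.zpowers x) := IsPGroup.of_card (by rw [Nat.card_zpowers, hk])
  obtain ⟨P, hP'⟩ := hP.exists_le_sylow
  have : P = Q := by
    obtain ⟨g, rfl⟩ := MulAction.exists_smul_eq X P Q
    exact (Sylow.smul_eq_of_normal (g := g⁻¹) (P := g • P)).symm.trans (by simp) |>.symm
  exact this ▸ hP' (Subgroup.mem_zpowers x)

/-- Primary elements of ⟨y⟩ for primes q ≠ p lie in a normal Sylow subgroup disjoint from the one
containing x; those for p itself are trivial. -/
theorem commute_of_isNilpotent [Group.IsNilpotent X] {p : ℕ} (hp : p.Prime) {x y : X}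
    (hx : ∃ k, orderOf x = p ^ k) (hy : (orderOf y).Coprime p) : Commute x y := by
  suffices h : Subgroup.zpowers y ≤ Subgroup.centralizer {x} from
    Subgroup.mem_centralizer_singleton_iff.1 (h (Subgroup.mem_zpowers y)) |>.symm
  refine le_of_forall_primary_mem fun q hq w hw hwq => ?_
  rw [Subgroup.mem_centralizer_singleton_iff]
  have : Fact p.Prime := ⟨hp⟩
  have : Fact q.Prime := ⟨hq⟩
  rcases eq_or_ne q p with rfl | hne
  · obtain ⟨k, hk⟩ := hwq
    have h1 := Nat.Coprime.coprime_dvd_left (orderOf_dvd_of_mem_zpowers hw) hy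
    have : k = 0 := by
      by_contra hk0
      rw [hk, Nat.coprime_pow_left_iff (Nat.pos_of_ne_zero hk0)] at h1
      exact hq.one_lt.ne' (by simpa using h1)
    have : w = 1 := orderOf_eq_one_iff.1 (by rw [hk, this, pow_zero])
    simp [this]
  · exact (Subgroup.commute_of_normal_of_disjoint _ _ inferInstance inferInstance
      (IsPGroup.disjoint_of_ne p q hne.symm _ _ (default : Sylow p X).isPGroup'
        (default : Sylow q X).isPGroup') x w (mem_sylow_of_normal hp _ hx)
        (mem_sylow_of_normal hq _ hwq)).symm.eq

/-- The elements of `p'`-order of a finite nilpotent group form a subgroup. -/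
theorem exists_normal_complement_of_isNilpotent [Group.IsNilpotent X] (p : Nat.Primes) :
    ∃ N : Subgroup X, N.Normal ∧ IsHallSubgroup {p}ᶜ N := by
  obtain ⟨N, h1, h2, h3⟩ := exists_radical {p}ᶜ X
  have : Fact (p : ℕ).Prime := ⟨p.2⟩
  let P : Sylow p X := default
  have htop : (⊤ : Subgroup X) ≤ (P : Subgroup X) ⊔ N := by
    refine le_of_forall_primary_mem fun q hq x _ hx => ?_
    have : Fact q.Prime := ⟨hq⟩
    rcases eq_or_ne q p with rfl | hne
    · exact Subgroup.mem_sup_left (mem_sylow_of_normal p.2 P hx)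
    · refine Subgroup.mem_sup_right (h3 (default : Sylow q X) inferInstance ?_
        (mem_sylow_of_normal hq _ hx))
      have := (default : Sylow q X).isPGroup'.isPiGroup (p := ⟨q, hq⟩)
      exact fun r hr h => hne (congrArg Subtype.val ((this hr).symm.trans h))
  refine ⟨N, h1, h2, fun q hq => ?_⟩
  simp only [compl_compl, Set.mem_singleton_iff]
  have h4 : N.index ∣ Nat.card P := by
    rw [← Subgroup.relIndex_top_right, ← top_le_iff.1 htop, Subgroup.relIndex_sup_right]
    exact Subgroup.relIndex_dvd_card _ _
  exact P.isPGroup'.isPiGroup (dvd_trans hq h4)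

end Elements

/-! ### Closure properties and structure of π-nilpotent groups. -/

section PiNilpotent

variable {π : Set Nat.Primes}

/-- Preimages of normal Hall p'-subgroups remain Hall p'-subgroups, since for p ∈ π the kernel has
order prime to p. -/
theorem PiNilpotent.of_hom {V Y : Type u} [Group V] [Group Y] [Finite V] [Finite Y] (f : V →* Y)
    (hker : IsPiGroup πᶜ f.ker) (hY : PiNilpotent π Y) : PiNilpotent π V := by
  intro p hp
  obtain ⟨N, hN, hN1, hN2⟩ := hY p hp
  refine ⟨N.comap f, hN.comap f, ?_, fun q hq => hN2 (dvd_trans hq ?_)⟩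
  · intro q hq hqp
    obtain rfl : q = p := hqp
    have h1 : Nat.card (N.comap f) = Nat.card f.ker * Nat.card ((N.comap f).map f) := by
      rw [← Subgroup.relIndex_ker, ← Subgroup.relIndex_bot_left, ← Subgroup.relIndex_bot_left]
      refine (Subgroup.relIndex_mul_relIndex _ _ _ bot_le fun x hx => ?_).symm
      simp [f.mem_ker.1 hx]
    have h2 : (q : ℕ) ∣ Nat.card (N.comap f) := hq
    rw [h1, q.2.dvd_mul] at h2
    rcases h2 with h2 | h2
    · exact hker h2 hp
    · exact hN1 (h2.trans (Subgroup.card_dvd_of_le (Subgroup.map_comap_le _ _))) rfl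
  · rw [Subgroup.index_comap]
    exact Subgroup.relIndex_dvd_index_of_normal _ _

theorem PiNilpotent.of_injective {V Y : Type u} [Group V] [Group Y] [Finite V] [Finite Y]
    (f : V →* Y) (hf : Function.Injective f) (hY : PiNilpotent π Y) : PiNilpotent π V :=
  hY.of_hom f (by rw [(MonoidHom.ker_eq_bot_iff f).2 hf]; exact isPiGroup_bot)

theorem PiNilpotent.of_surjective {V Y : Type u} [Group V] [Group Y] [Finite V] [Finite Y]
    (f : V →* Y) (hf : Function.Surjective f) (hV : PiNilpotent π V) : PiNilpotent π Y := by
  intro p hp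
  obtain ⟨N, hN, hN1, hN2⟩ := hV p hp
  exact ⟨N.map f, hN.map f hf, hN1.map f, fun q hq => hN2 (dvd_trans hq
    (Subgroup.index_map_dvd N hf))⟩

theorem PiNilpotent.map {X Y : Type u} [Group X] [Group Y] [Finite X] [Finite Y] {H : Subgroup X}
    (hH : PiNilpotent π H) (f : X →* Y) : PiNilpotent π (H.map f) :=
  hH.of_surjective (f.subgroupMap H) (f.subgroupMap_surjective H)

theorem PiNilpotent.comap {X Y : Type u} [Group X] [Group Y] [Finite X] [Finite Y]
    {H : Subgroup Y} (hH : PiNilpotent π H) (f : X →* Y) (hker : IsPiGroup πᶜ f.ker) :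
    PiNilpotent π (H.comap f) := by
  refine hH.of_hom (f.subgroupComap H) (hker.of_card_dvd ?_)
  rw [Nat.card_congr ((f.subgroupComap H).ker.equivMapOfInjective (H.comap f).subtype
    (Subgroup.subtype_injective _)).toEquiv]
  refine Subgroup.card_dvd_of_le ?_
  rintro _ ⟨x, hx, rfl⟩
  exact congrArg Subtype.val (MonoidHom.mem_ker.1 hx)

theorem Group.IsNilpotent.piNilpotent {X : Type u} [Group X] [Finite X] (h : Group.IsNilpotent X) :
    PiNilpotent π X :=
  fun p _ => exists_normal_complement_of_isNilpotent p

/-- A `π`-nilpotent group is nilpotent modulo some normal `π'`-subgroup. -/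
theorem PiNilpotent.exists_normal {X : Type u} [Group X] [Finite X] (h : PiNilpotent π X) :
    ∃ W : Subgroup X, W.Normal ∧ IsPiGroup πᶜ W ∧
      (W = ⊥ → Group.IsNilpotent X ∧ IsPiGroup π X) := by
  choose! N hN hN1 hN2 using h
  -- W is the intersection of the normal Hall p'-subgroups. Only primes dividing |X| are used, so
  -- that X/W embeds in a finite product of p-groups.
  let ι := {p : Nat.Primes // (p : ℕ) ∈ (Nat.card X).primeFactors ∧ p ∈ π}
  have : Finite ι := Finite.of_injective
    (fun i : ι => (⟨i.1, i.2.1⟩ : (Nat.card X).primeFactors)) fun i j hij => by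
      exact Subtype.ext (Nat.Primes.coe_nat_injective (by simpa using hij))
  have hnormal : ∀ i : ι, (N i.1).Normal := fun i => hN i.1 i.2.2
  have hq : ∀ i : ι, IsPGroup (i.1 : ℕ) (X ⧸ N i.1) := fun i =>
    IsPiGroup.isPGroup fun q hq => by
      have := hN2 i.1 i.2.2 (show (q : ℕ) ∣ (N i.1).index from hq)
      rwa [compl_compl] at this
  let f : X →* ((i : ι) → X ⧸ N i.1) := MonoidHom.pi fun i => QuotientGroup.mk' (N i.1)
  have hker : f.ker = ⨅ i : ι, N i.1 := by
    ext x
    simp only [MonoidHom.mem_ker, funext_iff, Subgroup.mem_iInf]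
    exact forall_congr' fun i => QuotientGroup.eq_one_iff x
  refine ⟨⨅ i : ι, N i.1, Subgroup.normal_iInf_normal hnormal, ?_, fun hW => ?_⟩
  · intro p hp hpπ
    have hpX : (p : ℕ) ∣ Nat.card X := dvd_trans hp (Subgroup.card_subgroup_dvd_card _)
    let i : ι := ⟨p, Nat.mem_primeFactors.2 ⟨p.2, hpX, Nat.card_pos.ne'⟩, hpπ⟩
    exact hN1 p hpπ (dvd_trans hp (Subgroup.card_dvd_of_le (iInf_le _ i))) rfl
  · rw [hW] at hker
    have hinj : Function.Injective f := (MonoidHom.ker_eq_bot_iff f).1 hker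
    have : ∀ i : ι, Group.IsNilpotent (X ⧸ N i.1) := fun i =>
      have : Fact (i.1 : ℕ).Prime := ⟨i.1.2⟩
      (hq i).isNilpotent
    have hnil : Group.IsNilpotent X :=
      Subgroup.isNilpotent_of_ker_le_center f (by rw [hker]; exact bot_le)
    refine ⟨hnil, fun q hqX => ?_⟩
    by_contra hqπ
    have : Fact (q : ℕ).Prime := ⟨q.2⟩
    obtain ⟨x, hx⟩ := exists_prime_orderOf_dvd_card' (G := X) q hqX
    have : x = 1 := hinj <| by
      rw [map_one]
      funext i
      have h1 : orderOf (f x i) ∣ q := by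
        rw [← hx]
        exact orderOf_map_dvd (QuotientGroup.mk' (N i.1)) x
      obtain ⟨k, hk⟩ := (isPGroup_iff_orderOf_dvd_pow.1 (hq i)) (f x i)
      rcases (Nat.dvd_prime q.2).1 h1 with h1 | h1
      · exact orderOf_eq_one_iff.1 h1
      · rw [h1] at hk
        have := (Nat.prime_dvd_prime_iff_eq q.2 i.1.2).1 (q.2.dvd_of_dvd_pow hk)
        exact absurd (Nat.Primes.coe_nat_injective this ▸ i.2.2) hqπ
    rw [this, orderOf_one] at hx
    exact q.2.one_lt.ne hx

end PiNilpotent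

/-! ### Sylow subgroups of a subgroup C, kept as subgroups of X: p-groups P ≤ C of index prime to p
in C. -/

section RelativeSylow

variable {X : Type u} [Group X] [Finite X] {p : ℕ} [hp : Fact p.Prime]

theorem IsPGroup.le_of_not_dvd_relIndex {P Q C : Subgroup X} (hPQ : P ≤ Q) (hQC : Q ≤ C)
    (hQ : IsPGroup p Q) (hP : ¬ p ∣ P.relIndex C) : Q ≤ P := by
  rw [← Subgroup.relIndex_eq_one]
  obtain ⟨n, hn⟩ := IsPGroup.iff_card.1 hQ
  obtain ⟨k, -, hk⟩ := (Nat.dvd_prime_pow hp.1).1 (hn ▸ Subgroup.relIndex_dvd_card P Q)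
  rcases Nat.eq_zero_or_pos k with rfl | hk0
  · simpa using hk
  · refine absurd ?_ hP
    rw [← Subgroup.relIndex_mul_relIndex P Q C hPQ hQC, hk]
    exact dvd_mul_of_dvd_left (dvd_pow_self p hk0.ne') _

theorem IsPGroup.exists_le_not_dvd_relIndex {Q C : Subgroup X} (hQC : Q ≤ C) (hQ : IsPGroup p Q) :
    ∃ P, Q ≤ P ∧ P ≤ C ∧ IsPGroup p P ∧ ¬ p ∣ P.relIndex C := by
  obtain ⟨S, hS⟩ := (hQ.comap_subtype (K := C)).exists_le_sylow
  refine ⟨(S : Subgroup C).map C.subtype, fun x hx => ⟨⟨x, hQC hx⟩, hS hx, rfl⟩,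
    Subgroup.map_subtype_le _, S.isPGroup'.map _, ?_⟩
  rw [Subgroup.relIndex, Subgroup.subgroupOf,
    Subgroup.comap_map_eq_self_of_injective (Subgroup.subtype_injective C)]
  exact S.not_dvd_index

theorem IsPGroup.exists_conj_of_not_dvd_relIndex {P Q C : Subgroup X} (hPC : P ≤ C)
    (hP : IsPGroup p P) (hP' : ¬ p ∣ P.relIndex C) (hQC : Q ≤ C) (hQ : IsPGroup p Q)
    (hQ' : ¬ p ∣ Q.relIndex C) : ∃ c ∈ C, Q = P.map (MulAut.conj c).toMonoidHom := by
  let S : Sylow p C := (hP.comap_subtype (K := C)).toSylow hP'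
  let T : Sylow p C := (hQ.comap_subtype (K := C)).toSylow hQ'
  obtain ⟨c, hc⟩ := MulAction.exists_smul_eq C S T
  refine ⟨c, c.2, ?_⟩
  have h1 : ((T : Subgroup C)).map C.subtype = Q := Subgroup.map_subgroupOf_eq_of_le hQC
  have h2 : ((S : Subgroup C)).map C.subtype = P := Subgroup.map_subgroupOf_eq_of_le hPC
  rw [← h1, ← h2, ← hc, Sylow.coe_subgroup_smul, Subgroup.map_map]
  ext x
  constructor
  · rintro ⟨_, ⟨s, hs, rfl⟩, rfl⟩
    exact ⟨s, hs, rfl⟩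
  · rintro ⟨s, hs, rfl⟩
    exact ⟨_, ⟨s, hs, rfl⟩, rfl⟩

end RelativeSylow

/-! ### Intersections with subnormal subgroups and coprime centralization. -/

section Subnormal

variable {X : Type u} [Group X] [Finite X]

/-- Counted through |PN||P ∩ N| = |P||N|, since P need not be normal in PN. -/
theorem Subgroup.relIndex_sup_of_normal (P N : Subgroup X) [N.Normal] :
    P.relIndex (P ⊔ N) = P.relIndex N := by
  have hcard : ∀ {A B : Subgroup X}, A ≤ B → Nat.card A * A.relIndex B = Nat.card B := by
    intro A B h
    rw [← Subgroup.relIndex_bot_left, ← Subgroup.relIndex_bot_left]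
    exact Subgroup.relIndex_mul_relIndex _ _ _ bot_le h
  have h1 := hcard (le_sup_left : P ≤ P ⊔ N)
  have h2 := hcard (le_sup_right : N ≤ P ⊔ N)
  have h3 := hcard (inf_le_left : P ⊓ N ≤ P)
  have h4 := hcard (inf_le_right : P ⊓ N ≤ N)
  rw [Subgroup.inf_relIndex_left] at h3
  rw [Subgroup.inf_relIndex_right] at h4
  rw [Subgroup.relIndex_sup_right] at h2
  refine Nat.eq_of_mul_eq_mul_left (Nat.card_pos (α := P)) ?_
  rw [h1, ← h2, ← h4, ← h3]
  ring

/-- A Sylow subgroup meets a normal subgroup in a Sylow subgroup; apply this to C ∩ H ◁ C ∩ K at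
each step down the chain. -/
theorem Subgroup.IsSubnormal.not_dvd_relIndex_inf {p : ℕ} {P C K : Subgroup X} (hPC : P ≤ C)
    (hP' : ¬ p ∣ P.relIndex C) (hK : K.IsSubnormal) :
    ¬ p ∣ (P ⊓ K).relIndex (C ⊓ K) := by
  induction hK with
  | top => simpa using hP'
  | step H K h_le _ hN ih =>
    have : ((C ⊓ H).subgroupOf (C ⊓ K)).Normal := by
      refine ⟨fun n hn g => ⟨?_, ?_⟩⟩
      · exact (C ⊓ K).mul_mem ((C ⊓ K).mul_mem g.2 n.2) ((C ⊓ K).inv_mem g.2) |>.1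
      · exact hN.conj_mem ⟨n, n.2.2⟩ hn.2 ⟨g, g.2.2⟩
    intro hd
    apply ih
    have h1 : (P ⊓ K).relIndex (C ⊓ K) = ((P ⊓ K).subgroupOf (C ⊓ K)).index := rfl
    have e1 : (P ⊓ H).relIndex (C ⊓ H)
        = ((P ⊓ K).subgroupOf (C ⊓ K)).relIndex ((C ⊓ H).subgroupOf (C ⊓ K)) := by
      rw [Subgroup.relIndex_subgroupOf (inf_le_inf_left C h_le),
        ← Subgroup.inf_relIndex_right (P ⊓ K)]
      congr 1
      apply le_antisymm
      · exact le_inf (inf_le_inf_left _ h_le) (inf_le_inf_right _ hPC)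
      · exact le_inf (inf_le_left.trans inf_le_left) (inf_le_right.trans inf_le_right)
    rw [h1]
    rw [e1, ← Subgroup.relIndex_sup_of_normal] at hd
    exact hd.trans (Subgroup.relIndex_dvd_index_of_le le_sup_left)

end Subnormal

/-- If an element of a subnormal subgroup `K`, of order coprime to that of the normal
subgroup `A`, centralizes `A ⊓ K`, then it centralizes `A`. -/
theorem Subgroup.IsSubnormal.commute_of_coprime {X : Type u} [Group X] {A K : Subgroup X} [hA : A.Normal]
    (hK : K.IsSubnormal) {x : X} (hx : x ∈ K) (hcop : (orderOf x).Coprime (Nat.card A))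
    (h : ∀ a ∈ A, a ∈ K → Commute x a) : ∀ a ∈ A, Commute x a := by
  induction hK with
  | top => exact fun a ha => h a ha trivial
  | step H K h_le _ hN ih =>
    refine ih (h_le hx) fun a ha haK => ?_
    -- This commutator lies in A ∩ H, so x commutes with it and xⁿa = azⁿxⁿ. Taking n = |x| gives
    -- z^|x| = 1, while |z| divides |A|.
    set z := a⁻¹ * x * a * x⁻¹ with hz
    have hzA : z ∈ A := by
      have : z = a⁻¹ * (x * a * x⁻¹) := by simp [hz, mul_assoc]
      rw [this]
      exact mul_mem (inv_mem ha) (hA.conj_mem a ha x)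
    have hzH : z ∈ H := by
      have := hN.conj_mem ⟨x, h_le hx⟩ hx ⟨a⁻¹, inv_mem haK⟩
      have h2 : a⁻¹ * x * a ∈ H := by simpa using Subgroup.mem_subgroupOf.1 this
      exact mul_mem h2 (inv_mem hx)
    have hc : Commute x z := h z hzA hzH
    have hn : ∀ n : ℕ, x ^ n * a = a * z ^ n * x ^ n := by
      intro n
      induction n with
      | zero => simp
      | succ n ihn =>
        have h3 : x * a = a * z * x := by simp [hz, mul_assoc]
        calc x ^ (n + 1) * a = x * (x ^ n * a) := by rw [pow_succ', mul_assoc]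
          _ = x * a * z ^ n * x ^ n := by rw [ihn]; simp only [mul_assoc]
          _ = a * z * (x * z ^ n) * x ^ n := by rw [h3]; simp only [mul_assoc]
          _ = a * z * (z ^ n * x) * x ^ n := by rw [(hc.pow_right n).eq]
          _ = a * z ^ (n + 1) * x ^ (n + 1) := by
            rw [pow_succ' z, pow_succ' x]; simp only [mul_assoc]
    have h1 := hn (orderOf x)
    rw [pow_orderOf_eq_one, one_mul, mul_one, left_eq_mul] at h1
    have h2 : orderOf z ∣ Nat.card A := by
      exact Subgroup.orderOf_dvd_natCard A hzA
    have h3 : z = 1 := orderOf_eq_one_iff.1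
      (Nat.eq_one_of_dvd_coprimes hcop (orderOf_dvd_of_pow_eq_one h1) h2)
    rw [hz, mul_inv_eq_one, mul_assoc, inv_mul_eq_iff_eq_mul] at h3
    exact h3

/-! ### Mann's construction over a normal nilpotent subgroup F. -/

section MannFamily

variable {π : Set Nat.Primes} {X : Type u} [Group X]

/-- The centralizer of the `p'`-elements of `F`. -/
def primaryCentralizer (F : Subgroup X) (p : ℕ) : Subgroup X :=
  Subgroup.centralizer {a | a ∈ F ∧ (orderOf a).Coprime p}

theorem mem_primaryCentralizer {F : Subgroup X} {p : ℕ} {x : X} :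
    x ∈ primaryCentralizer F p ↔ ∀ a ∈ F, (orderOf a).Coprime p → Commute a x :=
  ⟨fun h a ha hp => Subgroup.mem_centralizer_iff.1 h a ⟨ha, hp⟩,
    fun h => Subgroup.mem_centralizer_iff.2 fun a ha => h a ha.1 ha.2⟩

theorem orderOf_conj (g a : X) : orderOf (g * a * g⁻¹) = orderOf a :=
  orderOf_injective (MulAut.conj g).toMonoidHom (MulAut.conj g).injective a

instance primaryCentralizer_normal (F : Subgroup X) [hF : F.Normal] (p : ℕ) :
    (primaryCentralizer F p).Normal := by
  refine ⟨fun n hn g => mem_primaryCentralizer.2 fun a ha hap => ?_⟩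
  have h1 := mem_primaryCentralizer.1 hn (g⁻¹ * a * g) (by simpa using hF.conj_mem a ha g⁻¹)
    (by
      have := orderOf_conj g⁻¹ a
      rw [inv_inv] at this
      rwa [this])
  have h2 := h1.map (MulAut.conj g).toMonoidHom
  simpa [mul_assoc] using h2

/-- A choice of a Sylow `p`-subgroup of the centralizer of the `p'`-elements of `F`, for each
prime `p`. -/
structure IsMannFamily (F : Subgroup X) (P : Nat.Primes → Subgroup X) : Prop where
  isPGroup : ∀ p : Nat.Primes, IsPGroup (p : ℕ) (P p)
  le : ∀ p : Nat.Primes, P p ≤ primaryCentralizer F p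
  not_dvd : ∀ p : Nat.Primes, ¬ (p : ℕ) ∣ (P p).relIndex (primaryCentralizer F p)

theorem IsMannFamily.conj {F : Subgroup X} [hF : F.Normal] {P : Nat.Primes → Subgroup X}
    (h : IsMannFamily F P) (g : X) :
    IsMannFamily F fun p => (P p).map (MulAut.conj g).toMonoidHom := by
  have hC : ∀ p, (primaryCentralizer F p).map (MulAut.conj g).toMonoidHom
      = primaryCentralizer F p := fun p =>
    (Subgroup.Normal.map_conj_eq (primaryCentralizer F p) g)
  refine ⟨fun p => (h.isPGroup p).map _, fun p => ?_, fun p => ?_⟩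
  · rw [← hC p]
    exact Subgroup.map_mono (h.le p)
  · rw [← hC p, Subgroup.relIndex_map_map_of_injective _ _ (MulAut.conj g).injective]
    exact h.not_dvd p

variable [Finite X] {F : Subgroup X}

instance (p : Nat.Primes) : Fact (p : ℕ).Prime := ⟨p.2⟩

theorem exists_primary_decomposition_mem {p : ℕ} (hp : p.Prime) {z : X} (hz : z ∈ F) :
    ∃ a ∈ F, ∃ b ∈ F, z = a * b ∧ (∃ k, orderOf a = p ^ k) ∧ (orderOf b).Coprime p := by
  obtain ⟨a, ha, b, hb, h⟩ := exists_primary_decomposition hp z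
  have hle : Subgroup.zpowers z ≤ F := by simpa using hz
  exact ⟨a, hle ha, b, hle hb, h⟩

/-- The p'-part of an element of F is centralized by C_p, and its p-part, being a q'-element, by
C_q. -/
theorem primaryCentralizer_inf_le {p q : ℕ} (hp : p.Prime) (hq : q.Prime) (hpq : p ≠ q) :
    primaryCentralizer F p ⊓ primaryCentralizer F q ≤ Subgroup.centralizer (F : Set X) := by
  rintro x ⟨hxp, hxq⟩
  refine Subgroup.mem_centralizer_iff.2 fun z hz => ?_
  obtain ⟨a, ha, b, hb, rfl, ⟨k, hk⟩, hbp⟩ := exists_primary_decomposition_mem hp hz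
  exact (mem_primaryCentralizer.1 hxq a ha (by
    rw [hk]; exact Nat.Coprime.pow_left k ((Nat.coprime_primes hp hq).2 hpq))).mul_left
    (mem_primaryCentralizer.1 hxp b hb hbp)

theorem commute_of_mem_isNilpotent {U : Subgroup X} (hU : Group.IsNilpotent U) {p : ℕ}
    (hp : p.Prime) {x y : X} (hxU : x ∈ U) (hyU : y ∈ U) (hx : ∃ k, orderOf x = p ^ k)
    (hy : (orderOf y).Coprime p) : Commute x y :=
  congrArg Subtype.val (commute_of_isNilpotent (X := U) hp (x := ⟨x, hxU⟩) (y := ⟨y, hyU⟩)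
    (by simpa using hx) (by simpa using hy)).eq

theorem orderOf_of_mem_isPGroup {X : Type u} [Group X] {p : Nat.Primes} {P : Subgroup X} (hP : IsPGroup (p : ℕ) P) {x : X}
    (hx : x ∈ P) : ∃ k, orderOf x = (p : ℕ) ^ k := by
  simpa using IsPGroup.iff_orderOf.1 hP ⟨x, hx⟩

/-- A Sylow p-subgroup of U centralizes the p'-elements of F, so it extends to a Sylow p-subgroup of
C_p. -/
theorem exists_isMannFamily_of_isNilpotent {U : Subgroup X} (hU : Group.IsNilpotent U)
    (hFU : F ≤ U) : ∃ P, IsMannFamily F P ∧ U ≤ ⨆ p, P p := by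
  have key : ∀ p : Nat.Primes, ∃ P : Subgroup X,
      ((default : Sylow p U) : Subgroup U).map U.subtype ≤ P ∧ P ≤ primaryCentralizer F p ∧
        IsPGroup (p : ℕ) P ∧ ¬ (p : ℕ) ∣ P.relIndex (primaryCentralizer F p) := fun p => by
    have hQ : IsPGroup (p : ℕ) (((default : Sylow p U) : Subgroup U).map U.subtype) :=
      (default : Sylow p U).isPGroup'.map _
    refine IsPGroup.exists_le_not_dvd_relIndex (fun x hx => ?_) hQ
    exact mem_primaryCentralizer.2 fun a ha hap => (commute_of_mem_isNilpotent hU p.2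
      (Subgroup.map_subtype_le _ hx) (hFU ha) (orderOf_of_mem_isPGroup hQ hx) hap).symm
  choose P h1 h2 h3 h4 using key
  exact ⟨P, ⟨h3, h2, h4⟩, le_of_forall_sylow_le fun p hp =>
    ⟨default, (h1 ⟨p, hp⟩).trans (le_iSup P ⟨p, hp⟩)⟩⟩

variable [hFn : F.Normal]

/-- The Sylow p-subgroup of F is a normal p-subgroup of X inside C_p, hence lies in every Sylow
p-subgroup of C_p. -/
theorem mem_isMannFamily_of_mem (hF : Group.IsNilpotent F) {P : Nat.Primes → Subgroup X}
    (h : IsMannFamily F P) (p : Nat.Primes) {a : X} (ha : a ∈ F)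
    (hap : ∃ k, orderOf a = (p : ℕ) ^ k) : a ∈ P p := by
  let Q : Sylow p F := default
  let N := (Q : Subgroup F).map F.subtype
  have hmem : ∀ x ∈ F, (∃ k, orderOf x = (p : ℕ) ^ k) → x ∈ N := fun x hx hxp =>
    ⟨⟨x, hx⟩, mem_sylow_of_normal p.2 Q (by simpa using hxp), rfl⟩
  have hNp : IsPGroup (p : ℕ) N := Q.isPGroup'.map _
  have hNF : N ≤ F := Subgroup.map_subtype_le _
  have hN : N.Normal := ⟨fun n hn g => hmem _ (hFn.conj_mem n (hNF hn) g) (by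
    rw [orderOf_conj]; exact orderOf_of_mem_isPGroup hNp hn)⟩
  have hNC : N ≤ primaryCentralizer F p := fun x hx => mem_primaryCentralizer.2 fun y hy hyp =>
    (commute_of_mem_isNilpotent hF p.2 (hNF hx) hy (orderOf_of_mem_isPGroup hNp hx) hyp).symm
  exact IsPGroup.le_of_not_dvd_relIndex le_sup_right (sup_le hNC (h.le p))
    (hNp.to_sup_of_normal_left (h.isPGroup p)) (h.not_dvd p) (Subgroup.mem_sup_left (hmem a ha hap))

theorem IsMannFamily.le_iSup_of_isNilpotent {P : Nat.Primes → Subgroup X} (h : IsMannFamily F P)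
    (hF : Group.IsNilpotent F) : F ≤ ⨆ p, P p :=
  le_of_forall_primary_mem fun p hp _ hx hxp =>
    Subgroup.mem_iSup_of_mem ⟨p, hp⟩ (mem_isMannFamily_of_mem hF h ⟨p, hp⟩ hx hxp)

/-- The commutator [c, x] lies in C_p ∩ C_q ≤ F; write it as ab with p-part a and p'-part b. Then
cxc⁻¹ = b(ax), where ax ∈ P_p commutes with b. Since cxc⁻¹ is a p-element, b = 1. -/
theorem IsMannFamily.conj_mem {P : Nat.Primes → Subgroup X} (h : IsMannFamily F P)
    (hF : Group.IsNilpotent F) (hC : Subgroup.centralizer (F : Set X) ≤ F) {p q : Nat.Primes}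
    (hpq : p ≠ q) {c x : X} (hc : c ∈ primaryCentralizer F q) (hx : x ∈ P p) :
    c * x * c⁻¹ ∈ P p := by
  have hxC := h.le p hx
  have hz : c * x * c⁻¹ * x⁻¹ ∈ F := by
    apply hC
    refine primaryCentralizer_inf_le p.2 q.2 (fun h => hpq (Nat.Primes.coe_nat_injective h))
      (Subgroup.mem_inf.2 ⟨mul_mem ((primaryCentralizer_normal F p).conj_mem x hxC c)
        (inv_mem hxC), ?_⟩)
    have := mul_mem hc ((primaryCentralizer_normal F q).conj_mem c⁻¹ (inv_mem hc) x)
    simpa [mul_assoc] using this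
  obtain ⟨a, ha, b, hb, hab, hap, hbp⟩ := exists_primary_decomposition_mem p.2 hz
  have hay : a * x ∈ P p := mul_mem (mem_isMannFamily_of_mem hF h p ha hap) hx
  have hcomm : Commute a b := commute_of_mem_isNilpotent hF p.2 ha hb hap hbp
  have h1 : c * x * c⁻¹ = b * (a * x) := by
    rw [← mul_assoc, ← hcomm.eq, ← hab]; simp
  have hby : Commute b (a * x) := mem_primaryCentralizer.1 (h.le p hay) b hb hbp
  obtain ⟨k, hk⟩ := orderOf_of_mem_isPGroup (h.isPGroup p) hx
  obtain ⟨l, hl⟩ := orderOf_of_mem_isPGroup (h.isPGroup p) hay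
  have h2 : b ^ (p : ℕ) ^ (k + l) = 1 := by
    have e1 : (b * (a * x)) ^ (p : ℕ) ^ (k + l) = 1 := by
      rw [← h1, ← orderOf_dvd_iff_pow_eq_one, orderOf_conj, hk]
      exact pow_dvd_pow _ (Nat.le_add_right k l)
    have e2 : (a * x) ^ (p : ℕ) ^ (k + l) = 1 := by
      rw [← orderOf_dvd_iff_pow_eq_one, hl]
      exact pow_dvd_pow _ (Nat.le_add_left l k)
    rwa [hby.mul_pow, e2, mul_one] at e1
  have hb1 : b = 1 := orderOf_eq_one_iff.1 (Nat.eq_one_of_dvd_coprimes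
    (hbp.pow_right (k + l)) dvd_rfl (orderOf_dvd_of_pow_eq_one h2))
  rw [h1, hb1, one_mul]
  exact hay

/-- P_p and P_q normalize each other, so their commutators lie in P_p ∩ P_q = 1. -/
theorem IsMannFamily.commute {P : Nat.Primes → Subgroup X} (h : IsMannFamily F P)
    (hF : Group.IsNilpotent F) (hC : Subgroup.centralizer (F : Set X) ≤ F) {p q : Nat.Primes}
    (hpq : p ≠ q) {x y : X} (hx : x ∈ P p) (hy : y ∈ P q) : Commute x y := by
  have h1 := mul_mem hx (h.conj_mem hF hC hpq (h.le q hy) (inv_mem hx))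
  have h2 := mul_mem (h.conj_mem hF hC hpq.symm (h.le p hx) hy) (inv_mem hy)
  have h3 := Subgroup.disjoint_def.1 (IsPGroup.disjoint_of_ne (p : ℕ) q
    (fun h => hpq (Nat.Primes.coe_nat_injective h)) _ _ (h.isPGroup p) (h.isPGroup q)) h1
    (by simpa [mul_assoc] using h2)
  rw [← mul_assoc, ← mul_assoc, mul_inv_eq_one] at h3
  exact mul_inv_eq_iff_eq_mul.1 h3

theorem IsMannFamily.isNilpotent_iSup {P : Nat.Primes → Subgroup X} (h : IsMannFamily F P)
    (hF : Group.IsNilpotent F) (hC : Subgroup.centralizer (F : Set X) ≤ F) :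
    Group.IsNilpotent (⨆ p, P p : Subgroup X) := by
  -- For other primes P_p is trivial; the join becomes the image of a finite direct product of
  -- p-groups.
  let ι := {p : Nat.Primes // (p : ℕ) ∈ (Nat.card X).primeFactors}
  have : Finite ι := Finite.of_injective
    (fun i : ι => (⟨i.1, i.2⟩ : (Nat.card X).primeFactors)) fun i j hij =>
      Subtype.ext (Nat.Primes.coe_nat_injective (by simpa using hij))
  have := Fintype.ofFinite ι
  have hsup : ⨆ p, P p = ⨆ i : ι, P i.1 := by
    refine le_antisymm (iSup_le fun p x hx => ?_) (iSup_le fun i => le_iSup P i.1)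
    rcases eq_or_ne x 1 with rfl | hx1
    · exact one_mem _
    · have h1 : (p : ℕ) ∣ Nat.card X := by
        have := (h.isPGroup p).dvd_orderOf (g := ⟨x, hx⟩) (by simpa using hx1)
        rw [Subgroup.orderOf_mk] at this
        exact this.trans (orderOf_dvd_natCard x)
      exact Subgroup.mem_iSup_of_mem (⟨p, Nat.mem_primeFactors.2 ⟨p.2, h1, Nat.card_pos.ne'⟩⟩ : ι)
        hx
  have hcomm : Pairwise fun i j : ι => ∀ x y : X, x ∈ P i.1 → y ∈ P j.1 → Commute x y :=
    fun i j hij x y hx hy => h.commute hF hC (fun e => hij (Subtype.ext e)) hx hy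
  have : ∀ i : ι, Group.IsNilpotent (P i.1) := fun i => (h.isPGroup i.1).isNilpotent
  rw [hsup, ← Subgroup.noncommPiCoprod_range (hcomm := hcomm)]
  exact Group.nilpotent_of_surjective _ (MonoidHom.rangeRestrict_surjective _)

/-- Primes are treated one at a time: the element of C_q correcting the q-th term normalizes the
terms already matched. -/
theorem IsMannFamily.exists_conj {P Q : Nat.Primes → Subgroup X} (hP : IsMannFamily F P)
    (hQ : IsMannFamily F Q) (hF : Group.IsNilpotent F)
    (hC : Subgroup.centralizer (F : Set X) ≤ F) :
    ∃ g : X, ⨆ p, Q p = (⨆ p, P p).map (MulAut.conj g).toMonoidHom := by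
  classical
  have key : ∀ s : Finset Nat.Primes, ∃ g : X, ∀ p ∈ s,
      Q p = (P p).map (MulAut.conj g).toMonoidHom := by
    intro s
    induction s using Finset.induction_on with
    | empty => exact ⟨1, by simp⟩
    | insert q s hq ih =>
      obtain ⟨g, hg⟩ := ih
      have hPg := hP.conj g
      obtain ⟨c, hc, hQc⟩ := IsPGroup.exists_conj_of_not_dvd_relIndex (hPg.le q) (hPg.isPGroup q)
        (hPg.not_dvd q) (hQ.le q) (hQ.isPGroup q) (hQ.not_dvd q)
      refine ⟨c * g, fun p hp => ?_⟩
      have e : (P p).map (MulAut.conj (c * g)).toMonoidHom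
          = ((P p).map (MulAut.conj g).toMonoidHom).map (MulAut.conj c).toMonoidHom := by
        rw [Subgroup.map_map]
        congr 1
        ext x
        simp [mul_assoc]
      rw [e]
      rcases Finset.mem_insert.1 hp with rfl | hps
      · exact hQc
      · rw [← hg p hps]
        have hpq : p ≠ q := fun e => hq (e ▸ hps)
        apply le_antisymm
        · intro x hx
          have := hQ.conj_mem hF hC hpq (inv_mem hc) hx
          rw [inv_inv] at this
          exact ⟨c⁻¹ * x * c, this, by simp [mul_assoc]⟩
        · rintro _ ⟨x, hx, rfl⟩
          exact hQ.conj_mem hF hC hpq hc hx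
  have hbot : ∀ {R : Nat.Primes → Subgroup X}, IsMannFamily F R → ∀ p : Nat.Primes,
      ¬ (p : ℕ) ∣ Nat.card X → R p = ⊥ := by
    intro R hR p hp
    rw [Subgroup.eq_bot_iff_forall]
    intro x hx
    by_contra hx1
    have := (hR.isPGroup p).dvd_orderOf (g := ⟨x, hx⟩) (by simpa using hx1)
    rw [Subgroup.orderOf_mk] at this
    exact hp (this.trans (orderOf_dvd_natCard x))
  obtain ⟨g, hg⟩ := key ((Nat.card X).primeFactors.attach.image fun
    (p : {p // p ∈ (Nat.card X).primeFactors}) =>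
      (⟨p.1, Nat.prime_of_mem_primeFactors p.2⟩ : Nat.Primes))
  refine ⟨g, ?_⟩
  rw [Subgroup.map_iSup]
  refine iSup_congr fun p => ?_
  by_cases hp : (p : ℕ) ∣ Nat.card X
  · exact hg p (Finset.mem_image.2 ⟨⟨p, Nat.mem_primeFactors.2 ⟨p.2, hp, Nat.card_pos.ne'⟩⟩,
      Finset.mem_attach _ _, rfl⟩)
  · rw [hbot hP p hp, hbot hQ p hp, Subgroup.map_bot]

/-! ### Maximality in subnormal subgroups. -/

theorem exists_subgroup_mem_iff_coprime (hF : Group.IsNilpotent F) (p : Nat.Primes) :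
    ∃ A : Subgroup X, A.Normal ∧ (Nat.card A).Coprime p ∧
      ∀ a, a ∈ A ↔ a ∈ F ∧ (orderOf a).Coprime p := by
  obtain ⟨N, hN, hN1, hN2⟩ := exists_normal_complement_of_isNilpotent (X := F) p
  have hcop : (Nat.card (N.map F.subtype)).Coprime p := by
    refine ((Nat.Prime.coprime_iff_not_dvd p.2).2 fun hd => ?_).symm
    exact (hN1.map F.subtype) (show p ∈ sigma _ from hd) rfl
  have hiff : ∀ a, a ∈ N.map F.subtype ↔ a ∈ F ∧ (orderOf a).Coprime p := by
    refine fun a => ⟨fun ha => ⟨Subgroup.map_subtype_le _ ha,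
      Nat.Coprime.coprime_dvd_left (Subgroup.orderOf_dvd_natCard _ ha) hcop⟩, ?_⟩
    rintro ⟨ha, hap⟩
    have hq : IsPGroup (p : ℕ) (F ⧸ N) := IsPiGroup.isPGroup fun q hq => by
      have := hN2 (show (q : ℕ) ∣ N.index from hq)
      rwa [compl_compl] at this
    obtain ⟨k, hk⟩ := isPGroup_iff_orderOf_dvd_pow.1 hq (QuotientGroup.mk' N ⟨a, ha⟩)
    have h1 : orderOf (QuotientGroup.mk' N ⟨a, ha⟩) ∣ orderOf a := by
      rw [← Subgroup.orderOf_mk a ha]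
      exact orderOf_map_dvd _ _
    have h2 := orderOf_eq_one_iff.1 (Nat.eq_one_of_dvd_coprimes (hap.pow_right k) h1 hk)
    exact ⟨⟨a, ha⟩, (QuotientGroup.eq_one_iff _).1 h2, rfl⟩
  refine ⟨N.map F.subtype, ⟨fun n hn g => ?_⟩, hcop, hiff⟩
  rw [hiff] at hn ⊢
  exact ⟨hFn.conj_mem n hn.1 g, by rw [orderOf_conj]; exact hn.2⟩

/-- A `π`-nilpotent subgroup of a subnormal subgroup `K` containing `F ⊓ K` is nilpotent. -/
theorem isNilpotent_of_piNilpotent (hFπ : IsPiGroup π F)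
    (hC : Subgroup.centralizer (F : Set X) ≤ F) {K U : Subgroup X} (hK : K.IsSubnormal)
    (h1 : F ⊓ K ≤ U) (h2 : U ≤ K) (hU : PiNilpotent π U) :
    Group.IsNilpotent U ∧ IsPiGroup π U := by
  obtain ⟨W, hW, hWπ, hW1⟩ := hU.exists_normal
  apply hW1
  rw [Subgroup.eq_bot_iff_forall]
  intro w hw
  have hcop : (orderOf (w : X)).Coprime (Nat.card F) := by
    rw [Subgroup.orderOf_coe]
    exact Nat.Coprime.coprime_dvd_left (Subgroup.orderOf_dvd_natCard _ hw)
      (hFπ.coprime_card hWπ).symm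
  -- W and F ∩ U are normal in U of coprime orders, so they commute; subnormality of K extends this
  -- from F ∩ K to F. Then w ∈ C(F) ≤ F has order prime to |F|.
  have hwC : ∀ a ∈ F, Commute (w : X) a := by
    refine hK.commute_of_coprime (h2 w.2) hcop fun a ha haK => ?_
    have haU : a ∈ U := h1 ⟨ha, haK⟩
    have hFU : (F.subgroupOf U).Normal := inferInstance
    have hdisj : Disjoint W (F.subgroupOf U) := by
      refine Subgroup.disjoint_def.2 fun {x} hxW hxF => ?_
      refine orderOf_eq_one_iff.1 (Nat.eq_one_of_dvd_coprimes (hFπ.coprime_card hWπ) ?_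
        (Subgroup.orderOf_dvd_natCard _ hxW))
      rw [← Subgroup.orderOf_coe]
      exact Subgroup.orderOf_dvd_natCard _ hxF
    exact congrArg Subtype.val (Subgroup.commute_of_normal_of_disjoint _ _ hW hFU hdisj w ⟨a, haU⟩
      hw ha).eq
  have hwF : (w : X) ∈ F := hC (Subgroup.mem_centralizer_iff.2 fun a ha => (hwC a ha).symm.eq)
  exact Subtype.ext (orderOf_eq_one_iff.1 (Nat.eq_one_of_dvd_coprimes hcop dvd_rfl
    (Subgroup.orderOf_dvd_natCard _ hwF)))

/-- U is nilpotent, so its Sylow p-subgroup Q contains P_p ∩ K and centralizes the p'-elements of F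
∩ K, hence those of F. Thus Q ≤ C_p ∩ K, where P_p ∩ K is already Sylow. -/
theorem IsMannFamily.le_of_subnormal {P : Nat.Primes → Subgroup X} (hP : IsMannFamily F P)
    (hF : Group.IsNilpotent F) (hFπ : IsPiGroup π F)
    (hC : Subgroup.centralizer (F : Set X) ≤ F) {K U : Subgroup X} (hK : K.IsSubnormal)
    (h1 : (⨆ p, P p) ⊓ K ≤ U) (h2 : U ≤ K) (hU : PiNilpotent π U) : U ≤ ⨆ p, P p := by
  have hFK : F ⊓ K ≤ U := (inf_le_inf_right K (hP.le_iSup_of_isNilpotent hF)).trans h1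
  have hUn := (isNilpotent_of_piNilpotent hFπ hC hK hFK h2 hU).1
  refine le_of_forall_sylow_le fun p' hp' => ⟨default, ?_⟩
  obtain ⟨p, rfl⟩ : ∃ p : Nat.Primes, p' = p := ⟨⟨p', hp'⟩, rfl⟩
  let S : Sylow p U := default
  set Q : Subgroup X := (S : Subgroup U).map U.subtype
  have hQ : IsPGroup (p : ℕ) Q := S.isPGroup'.map _
  have hQU : Q ≤ U := Subgroup.map_subtype_le _
  have hPQ : P p ⊓ K ≤ Q := fun x hx =>
    have hxU : x ∈ U := h1 ⟨Subgroup.mem_iSup_of_mem p hx.1, hx.2⟩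
    ⟨⟨x, hxU⟩, mem_sylow_of_normal p.2 S (by
      simpa using orderOf_of_mem_isPGroup (hP.isPGroup p) hx.1), rfl⟩
  obtain ⟨A, hA, hAp, hAiff⟩ := exists_subgroup_mem_iff_coprime hF p
  have hQC : Q ≤ primaryCentralizer F p ⊓ K := by
    refine fun x hx => ⟨mem_primaryCentralizer.2 fun a ha hap => ?_, h2 (hQU hx)⟩
    have hxp := orderOf_of_mem_isPGroup hQ hx
    have hcop : (orderOf x).Coprime (Nat.card A) := by
      obtain ⟨k, hk⟩ := hxp
      rw [hk]
      exact Nat.Coprime.pow_left k hAp.symm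
    refine (hK.commute_of_coprime (h2 (hQU hx)) hcop (fun b hb hbK => ?_) a
      ((hAiff a).2 ⟨ha, hap⟩)).symm
    obtain ⟨hbF, hbp⟩ := (hAiff b).1 hb
    exact commute_of_mem_isNilpotent hUn p.2 (hQU hx) (hFK ⟨hbF, hbK⟩) hxp hbp
  exact (IsPGroup.le_of_not_dvd_relIndex hPQ hQC hQ
    (hK.not_dvd_relIndex_inf (hP.le p) (hP.not_dvd p))).trans
    (inf_le_left.trans (le_iSup P p))

end MannFamily

/-! ### π-soluble groups: Hall subgroups and a self-centralizing nilpotent subgroup. -/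

section PiSoluble

variable {π : Set Nat.Primes}

/-- `X` has a subnormal series each of whose factors has order divisible only by a single prime of
`π`, or only by primes outside `π`. -/
def HasPiSeries (π : Set Nat.Primes) (X : Type u) [Group X] : Prop :=
  ∃ (m : ℕ) (S : ℕ → Subgroup X), S 0 = ⊥ ∧ S m = ⊤ ∧ ∀ i < m, S i ≤ S (i + 1) ∧
    ((S i).subgroupOf (S (i + 1))).Normal ∧ ∃ ρ : Set Nat.Primes,
      ((∃ p ∈ π, ρ = {p}) ∨ ρ = πᶜ) ∧
        ∀ q : Nat.Primes, (q : ℕ) ∣ (S i).relIndex (S (i + 1)) → q ∈ ρ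

theorem IsPiSoluble.hasPiSeries {X : Type u} [Group X] [Finite X] (h : IsPiSoluble π X) :
    HasPiSeries π X := by
  obtain ⟨m, S, h0, hm, hS⟩ := h
  refine ⟨m, S, h0, hm, fun i hi => ?_⟩
  obtain ⟨hle, hn, ⟨p, hp, hpg⟩ | hπ⟩ := hS i hi
  · exact ⟨hle, hn, {p}, Or.inl ⟨p, hp, rfl⟩, fun q hq => hpg.isPiGroup hq⟩
  · exact ⟨hle, hn, πᶜ, Or.inr rfl, fun q hq => hπ hq⟩

theorem HasPiSeries.of_surjective {X Y : Type u} [Group X] [Group Y] (f : X →* Y)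
    (hf : Function.Surjective f) (h : HasPiSeries π X) : HasPiSeries π Y := by
  obtain ⟨m, S, h0, hm, hS⟩ := h
  refine ⟨m, fun i => (S i).map f, by simp [h0], by simp [hm, Subgroup.map_top_of_surjective f hf],
    fun i hi => ?_⟩
  obtain ⟨hle, hn, ρ, hρ, hq⟩ := hS i hi
  refine ⟨Subgroup.map_mono hle, ?_, ρ, hρ, fun q hqd => hq q (hqd.trans ?_)⟩
  · rw [Subgroup.normal_subgroupOf_iff_le_normalizer hle] at hn
    exact Subgroup.normal_subgroupOf_of_le_normalizer
      ((Subgroup.map_mono hn).trans ((S i).le_normalizer_map f))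
  · rw [← Subgroup.relIndex_comap]
    exact Subgroup.relIndex_dvd_of_le_left _ (Subgroup.le_comap_map f (S i))

/-- Every nontrivial normal subgroup of a `π`-soluble group contains a nontrivial normal subgroup
that is a `p`-group for some `p ∈ π` or a `π'`-group. -/
theorem HasPiSeries.exists_normal_le {X : Type u} [Group X] [Finite X] (h : HasPiSeries π X)
    {C : Subgroup X} (hC : C.Normal) (hC1 : C ≠ ⊥) :
    ∃ N ≤ C, N.Normal ∧ N ≠ ⊥ ∧ ∃ ρ : Set Nat.Primes,
      ((∃ p ∈ π, ρ = {p}) ∨ ρ = πᶜ) ∧ IsPiGroup ρ N := by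
  classical
  obtain ⟨m, S, h0, hm, hS⟩ := h
  have hsub : ∀ j ≤ m, (S (m - j)).IsSubnormal := by
    intro j
    induction j with
    | zero => intro _; simp [hm]
    | succ j ih =>
      intro hj
      have e : m - (j + 1) + 1 = m - j := by omega
      obtain ⟨hle, hn, -⟩ := hS (m - (j + 1)) (by omega)
      rw [e] at hle hn
      exact .step _ _ hle (ih (by omega)) hn
  -- The first nontrivial intersection S (k+1) ∩ C embeds in a factor of the series, so it is a
  -- subnormal ρ-group and lies in O_ρ(X). The required N is O_ρ(X) ∩ C.
  have hex : ∃ i, S i ⊓ C ≠ ⊥ := ⟨m, by rwa [hm, top_inf_eq]⟩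
  have him : Nat.find hex ≤ m := Nat.find_min' hex (by rwa [hm, top_inf_eq])
  obtain ⟨k, hk⟩ : ∃ k, Nat.find hex = k + 1 := Nat.exists_eq_succ_of_ne_zero fun h => by
    have := Nat.find_spec hex
    rw [h, h0, bot_inf_eq] at this
    exact this rfl
  have hT : S (k + 1) ⊓ C ≠ ⊥ := hk ▸ Nat.find_spec hex
  have hk0 : S k ⊓ C = ⊥ := not_not.1 (Nat.find_min hex (hk ▸ Nat.lt_succ_self k))
  have hTs : (S (k + 1) ⊓ C).IsSubnormal := by
    have := hsub (m - (k + 1)) (by omega)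
    rw [Nat.sub_sub_self (hk ▸ him)] at this
    exact this.inf hC.isSubnormal
  obtain ⟨hle, hn, ρ, hρ, hq⟩ := hS k (by omega)
  have hTρ : IsPiGroup ρ (S (k + 1) ⊓ C : Subgroup X) := by
    intro q hqd
    refine hq q (dvd_trans (show (q : ℕ) ∣ Nat.card (S (k + 1) ⊓ C : Subgroup X) from hqd) ?_)
    have e1 : Nat.card (S (k + 1) ⊓ C : Subgroup X) = (S k).relIndex (S (k + 1) ⊓ C) := by
      rw [← Subgroup.inf_relIndex_right, ← inf_assoc, inf_right_comm, hk0, bot_inf_eq,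
        Subgroup.relIndex_bot_left]
    rw [e1, ← Subgroup.relIndex_subgroupOf (inf_le_left : S (k + 1) ⊓ C ≤ S (k + 1))]
    exact Subgroup.relIndex_dvd_index_of_normal _ _
  have hrad := piRadical_normal ρ X
  refine ⟨piRadical ρ X ⊓ C, inf_le_right, inferInstance, fun hbot => hT ?_, ρ, hρ,
    (isPiGroup_piRadical ρ X).mono_subgroup inf_le_left⟩
  exact le_bot_iff.1 (hbot ▸ le_inf (hTs.le_piRadical hTρ) inf_le_right)

theorem card_comap_of_surjective {X Y : Type u} [Group X] [Group Y] (f : X →* Y)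
    (hf : Function.Surjective f) (H : Subgroup Y) :
    Nat.card (H.comap f) = Nat.card f.ker * Nat.card H := by
  have h1 : (H.comap f).map f = H := Subgroup.map_comap_eq_self_of_surjective hf H
  conv_rhs => rw [← h1]
  rw [← Subgroup.relIndex_ker, ← Subgroup.relIndex_bot_left, ← Subgroup.relIndex_bot_left]
  refine (Subgroup.relIndex_mul_relIndex _ _ _ bot_le fun x hx => ?_).symm
  simp [f.mem_ker.1 hx]

/-- Induction modulo a normal N: lift a Hall subgroup of X/N, and if N is a π'-group take a
Schur–Zassenhaus complement to N in the lift. -/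
theorem HasPiSeries.exists_isHallSubgroup {X : Type u} [Group X] [Finite X]
    (h : HasPiSeries π X) : ∃ H : Subgroup X, IsHallSubgroup π H := by
  induction hcard : Nat.card X using Nat.strong_induction_on generalizing X with
  | _ n ih =>
    rcases subsingleton_or_nontrivial X with hX | hX
    · refine ⟨⊥, isPiGroup_bot, fun q hq => absurd hq ?_⟩
      have : (⊥ : Subgroup X) = ⊤ := Subsingleton.elim _ _
      simp [this, q.2.one_lt.ne']
    · obtain ⟨N, -, hN, hN1, ρ, hρ, hNρ⟩ := h.exists_normal_le (C := ⊤) inferInstance top_ne_bot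
      have hs := QuotientGroup.mk'_surjective N
      have hcN : 1 < Nat.card N := (Subgroup.one_lt_card_iff_ne_bot N).2 hN1
      have hlt : Nat.card (X ⧸ N) < n := by
        rw [← hcard, ← Subgroup.card_mul_index N, ← Subgroup.index_eq_card]
        exact lt_mul_of_one_lt_left (Nat.pos_of_ne_zero Subgroup.index_ne_zero_of_finite) hcN
      obtain ⟨H, hH1, hH2⟩ := ih _ hlt (h.of_surjective _ hs) rfl
      set K := H.comap (QuotientGroup.mk' N) with hK
      have hKi : K.index = H.index := Subgroup.index_comap_of_surjective H hs
      have hKc : Nat.card K = Nat.card N * Nat.card H := by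
        rw [hK, card_comap_of_surjective _ hs, QuotientGroup.ker_mk']
      rcases hρ with ⟨p, hp, rfl⟩ | rfl
      · refine ⟨K, (IsPiGroup.of_card_dvd_mul ?_ hH1 hKc.dvd), by rwa [hKi]⟩
        exact hNρ.trans fun q hq => (Set.mem_singleton_iff.1 hq) ▸ hp
      · have hNK : N ≤ K := fun x hx => by
          simp [hK, (QuotientGroup.eq_one_iff x).2 hx]
        have hc1 : Nat.card (N.subgroupOf K) = Nat.card N :=
          Nat.card_congr (Subgroup.subgroupOfEquivOfLe hNK).toEquiv
        have hi1 : (N.subgroupOf K).index = Nat.card H := by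
          have := Subgroup.card_mul_index (N.subgroupOf K)
          rw [hc1, hKc] at this
          exact Nat.eq_of_mul_eq_mul_left Nat.card_pos this
        obtain ⟨L, hL⟩ := Subgroup.exists_right_complement'_of_coprime (N := N.subgroupOf K)
          (by rw [hc1, hi1]; exact (hH1.coprime_card hNρ).symm)
        have hLc : Nat.card L = Nat.card H := by
          have := hL.card_mul_card
          rw [hc1, hKc] at this
          exact Nat.eq_of_mul_eq_mul_left Nat.card_pos this
        have hLi : L.index = Nat.card N := by
          have := Subgroup.card_mul_index L
          rw [hLc, hKc, mul_comm (Nat.card N)] at this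
          exact Nat.eq_of_mul_eq_mul_left Nat.card_pos this
        refine ⟨L.map K.subtype, (hH1.of_card_dvd hLc.dvd).map _, fun q hq => ?_⟩
        rw [Set.mem_ofPred_eq, Subgroup.index_map_subtype, hLi, hKi, q.2.dvd_mul] at hq
        rcases hq with hq | hq
        exacts [hNρ hq, hH2 hq]

theorem Subgroup.isNilpotent_sup_of_commute {X : Type u} [Group X] {H K : Subgroup X}
    (hH : Group.IsNilpotent H) (hK : Group.IsNilpotent K)
    (h : ∀ x ∈ H, ∀ y ∈ K, Commute x y) : Group.IsNilpotent (H ⊔ K : Subgroup X) := by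
  let f := H.subtype.noncommCoprod K.subtype fun x y => h x x.2 y y.2
  have hf : f.range = H ⊔ K := by
    rw [show f.range = _ from MonoidHom.noncommCoprod_range _ _ _, Subgroup.range_subtype, Subgroup.range_subtype]
  rw [← hf]
  exact Group.nilpotent_of_surjective _ f.rangeRestrict_surjective

/-- A `π`-soluble group without nontrivial normal `π'`-subgroups has a normal nilpotent
`π`-subgroup containing its centralizer. -/
theorem HasPiSeries.exists_centralizer_le {X : Type u} [Group X] [Finite X] (h : HasPiSeries π X)
    (hX : piRadical πᶜ X = ⊥) : ∃ F : Subgroup X, F.Normal ∧ Group.IsNilpotent F ∧ IsPiGroup π F ∧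
      Subgroup.centralizer (F : Set X) ≤ F := by
  let S : Set (Subgroup X) := {N | N.Normal ∧ Group.IsNilpotent N ∧ IsPiGroup π N}
  obtain ⟨F, ⟨hF1, hF2, hF3⟩, hmax⟩ := (Set.toFinite S).exists_maximal
    ⟨⊥, inferInstance, inferInstance, isPiGroup_bot⟩
  refine ⟨F, hF1, hF2, hF3, ?_⟩
  set C := Subgroup.centralizer (F : Set X)
  have hCn : C.Normal := inferInstance
  set Z := C ⊓ F
  have hZn : Z.Normal := inferInstance
  have hs := QuotientGroup.mk'_surjective Z
  by_contra hCF
  have hC1 : C.map (QuotientGroup.mk' Z) ≠ ⊥ := fun hbot => hCF <| by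
    rw [Subgroup.map_eq_bot_iff, QuotientGroup.ker_mk'] at hbot
    exact hbot.trans inf_le_right
  obtain ⟨N', hN'C, hN', hN'1, ρ, hρ, hN'ρ⟩ := (h.of_surjective _ hs).exists_normal_le
    (hCn.map _ hs) hC1
  set N := N'.comap (QuotientGroup.mk' Z) with hN
  have hNn : N.Normal := hN'.comap _
  have hNC : N ≤ C := by
    refine (Subgroup.comap_mono hN'C).trans ?_
    rw [Subgroup.comap_map_eq, QuotientGroup.ker_mk']
    exact sup_le le_rfl inf_le_left
  have hNc : Nat.card N = Nat.card Z * Nat.card N' := by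
    rw [hN, card_comap_of_surjective _ hs, QuotientGroup.ker_mk']
  have hcomm : ∀ x ∈ N, ∀ y ∈ F, Commute x y := fun x hx y hy =>
    (Subgroup.mem_centralizer_iff.1 (hNC hx) y hy).symm
  have hZπ : IsPiGroup π Z := hF3.mono_subgroup inf_le_right
  -- Z is central in N. If N/Z is a p-group with p ∈ π, then N is nilpotent and NF contradicts the
  -- maximality of F.
  rcases hρ with ⟨p, hp, rfl⟩ | rfl
  · have hNπ : IsPiGroup π N := IsPiGroup.of_card_dvd_mul hZπ
      (hN'ρ.trans fun q hq => (Set.mem_singleton_iff.1 hq) ▸ hp) hNc.dvd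
    have : Group.IsNilpotent N' := hN'ρ.isPGroup.isNilpotent
    have hNnil : Group.IsNilpotent N := by
      refine Subgroup.isNilpotent_of_ker_le_center ((QuotientGroup.mk' Z).subgroupComap N') ?_
      intro x hx
      have hxZ : (x : X) ∈ Z :=
        (QuotientGroup.eq_one_iff _).1 (congrArg Subtype.val (MonoidHom.mem_ker.1 hx))
      exact Subgroup.mem_center_iff.2 fun g => Subtype.ext (hcomm g g.2 x hxZ.2).eq
    have hmem : N ⊔ F ∈ S := ⟨inferInstance, Subgroup.isNilpotent_sup_of_commute hNnil hF2 hcomm,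
      hNπ.of_card_dvd_mul hF3 (card_sup_dvd_of_le_normalizer N F fun x _ =>
        mem_normalizer_of_finite fun t ht => hF1.conj_mem t ht x)⟩
    have hNF : N ≤ F := le_sup_left.trans (hmax hmem le_sup_right)
    have hNZ : Nat.card N ≤ Nat.card Z := Nat.card_le_card_of_injective _
      (Subgroup.inclusion_injective (le_inf hNC hNF : N ≤ Z))
    have := (Subgroup.one_lt_card_iff_ne_bot N').2 hN'1
    have h2 : 0 < Nat.card Z := Nat.card_pos
    rw [hNc] at hNZ
    nlinarith
  -- If N/Z is a π'-group, a complement T of the central Z is normal in N, hence a subnormal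
  -- π'-subgroup of X; this contradicts O_{π'}(X) = 1.
  · have hZN : Z ≤ N := fun x hx => by simp [hN, (QuotientGroup.eq_one_iff x).2 hx]
    have hc1 : Nat.card (Z.subgroupOf N) = Nat.card Z :=
      Nat.card_congr (Subgroup.subgroupOfEquivOfLe hZN).toEquiv
    have hi1 : (Z.subgroupOf N).index = Nat.card N' := by
      have := Subgroup.card_mul_index (Z.subgroupOf N)
      rw [hc1, hNc] at this
      exact Nat.eq_of_mul_eq_mul_left Nat.card_pos this
    obtain ⟨T, hT⟩ := Subgroup.exists_right_complement'_of_coprime (N := Z.subgroupOf N)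
      (by rw [hc1, hi1]; exact hZπ.coprime_card hN'ρ)
    have hTc : Nat.card T = Nat.card N' := by
      have := hT.card_mul_card
      rw [hc1, hNc] at this
      exact Nat.eq_of_mul_eq_mul_left Nat.card_pos this
    have hTn : T.Normal := by
      refine ⟨fun t ht n => ?_⟩
      obtain ⟨⟨z, s⟩, hzs⟩ := hT.2 n
      obtain rfl : (z : N) * (s : N) = n := hzs
      have h1 := mul_mem (mul_mem s.2 ht) (inv_mem s.2)
      have h2 : Commute (z : N) (s * t * (s : N)⁻¹) :=
        Subtype.ext (hcomm (s * t * (s : N)⁻¹ : N) (Subtype.prop _) (z : N)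
          (Subgroup.mem_subgroupOf.1 z.2).2).symm.eq
      have h3 : (z : N) * s * t * ((z : N) * s)⁻¹ = s * t * (s : N)⁻¹ := by
        rw [mul_inv_rev, ← mul_assoc, mul_inv_eq_iff_eq_mul, ← h2.eq]
        simp only [mul_assoc]
      rwa [h3]
    have hTs : (T.map N.subtype).IsSubnormal := hTn.isSubnormal.trans' hNn.isSubnormal
    have hbot := hTs.le_piRadical ((hN'ρ.of_card_dvd hTc.dvd).map N.subtype)
    rw [hX, le_bot_iff, Subgroup.map_eq_bot_iff_of_injective _ N.subtype_injective] at hbot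
    rw [hbot, Subgroup.card_bot] at hTc
    exact hN'1 (Subgroup.card_eq_one.1 hTc.symm)

end PiSoluble

/-! ### Injectors as preimages of Mann products. -/

section Injectors

variable {π : Set Nat.Primes}

theorem Subgroup.isNilpotent_comap_of_injective {X Y : Type u} [Group X] [Group Y] (f : X →* Y)
    (hf : Function.Injective f) {H : Subgroup Y} (hH : Group.IsNilpotent H) :
    Group.IsNilpotent (H.comap f) := by
  refine Subgroup.isNilpotent_of_ker_le_center (f.subgroupComap H) fun x hx => ?_
  have : x = 1 := Subtype.ext (hf ((congrArg Subtype.val (MonoidHom.mem_ker.1 hx)).trans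
    (map_one f).symm))
  exact this ▸ one_mem _

theorem IsMannFamily.isInjector_comap {X Y : Type u} [Group X] [Group Y] [Finite X] [Finite Y]
    {F : Subgroup Y} [F.Normal] (hF : Group.IsNilpotent F) (hFπ : IsPiGroup π F)
    (hC : Subgroup.centralizer (F : Set Y) ≤ F) (f : X →* Y) (hf : Function.Surjective f)
    (hker : IsPiGroup πᶜ f.ker) {P : Nat.Primes → Subgroup Y} (hP : IsMannFamily F P) :
    IsInjector (PiNilpotent π) ((⨆ p, P p).comap f) := by
  intro K hK
  have hV : PiNilpotent π ((⨆ p, P p).comap f) :=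
    (hP.isNilpotent_iSup hF hC).piNilpotent.comap f hker
  refine ⟨hV.comap K.subtype (by rw [K.ker_subtype]; exact isPiGroup_bot), fun U hVU hU =>
    le_antisymm (fun u hu => ?_) hVU⟩
  refine hP.le_of_subnormal hF hFπ hC (hK.map hf) ?_ (Subgroup.map_mono
    (Subgroup.map_subtype_le U)) ((PiNilpotent.map hU K.subtype).map f) ⟨u, ⟨u, hu, rfl⟩, rfl⟩
  rintro _ ⟨hm, ⟨k, hk, rfl⟩⟩
  exact ⟨k, ⟨⟨k, hk⟩, hVU hm, rfl⟩, rfl⟩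

theorem IsMannFamily.isInjector_nilpotentPi {X : Type u} [Group X] [Finite X]
    (hX : IsPiGroup π X) {F : Subgroup X} [F.Normal] (hF : Group.IsNilpotent F)
    (hC : Subgroup.centralizer (F : Set X) ≤ F) {P : Nat.Primes → Subgroup X}
    (hP : IsMannFamily F P) : IsInjector (NilpotentPi π) (⨆ p, P p) := by
  intro K hK
  refine ⟨⟨Subgroup.isNilpotent_comap_of_injective K.subtype K.subtype_injective
    (hP.isNilpotent_iSup hF hC), (hX.subgroup K).subgroup _⟩, fun U hVU hU =>
    le_antisymm (fun u hu => ?_) hVU⟩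
  refine hP.le_of_subnormal hF (hX.subgroup F) hC hK ?_ (Subgroup.map_subtype_le U)
    (PiNilpotent.map hU.1.piNilpotent K.subtype) ⟨u, hu, rfl⟩
  exact fun k hk => ⟨⟨k, hk.2⟩, hVU hk.1, rfl⟩

/-- Used to carry the construction from G/R to a Hall subgroup embedded in it. The image of the new
centralizer lies between P_p and C_p, so the index stays prime to p. -/
theorem IsMannFamily.comap {X Y : Type u} [Group X] [Group Y] [Finite X] [Finite Y] (f : X →* Y)
    (hf : Function.Injective f) {F : Subgroup Y} (hFf : F ≤ f.range)
    {P : Nat.Primes → Subgroup Y} (hP : IsMannFamily F P) (hPf : ∀ p, P p ≤ f.range) :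
    IsMannFamily (F.comap f) fun p => (P p).comap f := by
  have hle : ∀ p : Nat.Primes, (P p).comap f ≤ primaryCentralizer (F.comap f) p :=
    fun p x hx => mem_primaryCentralizer.2 fun a ha hap => hf (by
      have := mem_primaryCentralizer.1 (hP.le p hx) (f a) ha (by rwa [orderOf_injective f hf])
      simpa using this.eq)
  refine ⟨fun p => (hP.isPGroup p).comap_of_injective f hf, hle, fun p hd => hP.not_dvd p ?_⟩
  rw [Subgroup.relIndex_comap] at hd
  have h1 : P p ≤ (primaryCentralizer (F.comap f) p).map f := fun y hy => by
    obtain ⟨x, rfl⟩ := hPf p hy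
    exact ⟨x, hle p hy, rfl⟩
  have h2 : (primaryCentralizer (F.comap f) p).map f ≤ primaryCentralizer F p := by
    rintro _ ⟨x, hx, rfl⟩
    refine mem_primaryCentralizer.2 fun a ha hap => ?_
    obtain ⟨b, rfl⟩ := hFf ha
    exact (mem_primaryCentralizer.1 hx b ha (by rwa [orderOf_injective f hf] at hap)).map f
  rw [← Subgroup.relIndex_mul_relIndex _ _ _ h1 h2]
  exact dvd_mul_of_dvd_left hd _

theorem Subgroup.iSup_comap_of_injective {ι : Sort*} {X Y : Type*} [Group X] [Group Y] (f : X →* Y)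
    (hf : Function.Injective f) {P : ι → Subgroup Y} (hPf : ∀ i, P i ≤ f.range) :
    ⨆ i, (P i).comap f = (⨆ i, P i).comap f := by
  rw [← Subgroup.comap_map_eq_self_of_injective hf (⨆ i, (P i).comap f), Subgroup.map_iSup]
  congr 1
  exact iSup_congr fun i => Subgroup.map_comap_eq_self (hPf i)

theorem IsHallSubgroup.map {X Y : Type u} [Group X] [Group Y] {H : Subgroup X}
    (h : IsHallSubgroup π H) (f : X →* Y) (hf : Function.Surjective f) :
    IsHallSubgroup π (H.map f) :=
  ⟨h.1.map f, fun _ hq => h.2 (dvd_trans hq (Subgroup.index_map_dvd H hf))⟩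

theorem IsHallSubgroup.not_dvd_relIndex {X : Type u} [Group X] [Finite X] {H : Subgroup X}
    (h : IsHallSubgroup π H) (N : Subgroup X) [N.Normal] {p : Nat.Primes} (hp : p ∈ π) :
    ¬ (p : ℕ) ∣ H.relIndex N := by
  rw [← Subgroup.relIndex_sup_of_normal]
  exact fun hd => h.2 (hd.trans (Subgroup.relIndex_dvd_index_of_le le_sup_left)) hp

theorem IsHallSubgroup.le_of_normal {X : Type u} [Group X] [Finite X] {H : Subgroup X}
    (h : IsHallSubgroup π H) {N : Subgroup X} [N.Normal] (hN : IsPiGroup π N) : N ≤ H := by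
  rw [← Subgroup.relIndex_eq_one, Nat.eq_one_iff_not_exists_prime_dvd]
  intro p hp hd
  exact h.not_dvd_relIndex N (p := ⟨p, hp⟩) (hN (hd.trans (Subgroup.relIndex_dvd_card _ _))) hd

/-- For p ∈ π, H ∩ C_p has index prime to p in the normal subgroup C_p, so its Sylow p-subgroups
serve. For p ∉ π all of F consists of p'-elements, so C_p = C(F) ≤ F has order prime to p. -/
theorem IsHallSubgroup.exists_isMannFamily {X : Type u} [Group X] [Finite X] {H F : Subgroup X}
    [F.Normal] (h : IsHallSubgroup π H) (hFπ : IsPiGroup π F)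
    (hC : Subgroup.centralizer (F : Set X) ≤ F) :
    ∃ P, IsMannFamily F P ∧ ∀ p, P p ≤ H := by
  have key : ∀ p : Nat.Primes, ∃ P : Subgroup X, P ≤ H ∧ P ≤ primaryCentralizer F p ∧
      IsPGroup (p : ℕ) P ∧ ¬ (p : ℕ) ∣ P.relIndex (primaryCentralizer F p) := by
    intro p
    obtain ⟨P, -, h1, h2, h3⟩ := IsPGroup.exists_le_not_dvd_relIndex (p := (p : ℕ))
      (bot_le : ⊥ ≤ H ⊓ primaryCentralizer F p) IsPGroup.of_bot
    refine ⟨P, h1.trans inf_le_left, h1.trans inf_le_right, h2, fun hd => ?_⟩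
    rw [← Subgroup.relIndex_mul_relIndex _ _ _ h1 inf_le_right, p.2.dvd_mul,
      Subgroup.inf_relIndex_right] at hd
    have hd' := hd.resolve_left h3
    refine h.not_dvd_relIndex _ ?_ hd'
    by_contra hpπ
    have hle : primaryCentralizer F p ≤ F := by
      refine le_trans (fun x hx => Subgroup.mem_centralizer_iff.2 fun a ha => ?_) hC
      refine mem_primaryCentralizer.1 hx a ha ((Nat.Prime.coprime_iff_not_dvd p.2).2 ?_).symm
      exact fun hd => hpπ (hFπ.mem_of_dvd_orderOf ha p hd)
    exact hpπ (hFπ.mono_subgroup hle (hd'.trans (Subgroup.relIndex_dvd_card _ _)))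
  choose P h1 h2 h3 h4 using key
  exact ⟨P, ⟨h3, h2, h4⟩, h1⟩

theorem IsInjector.le_of_normal {X : Type u} [Group X] {𝔉 : GroupClass.{u}} {V N : Subgroup X}
    (hV : IsInjector 𝔉 V) (hN : N.Normal) (h : 𝔉 (⊤ : Subgroup N)) : N ≤ V := by
  rw [← Subgroup.subgroupOf_eq_top]
  exact ((hV N hN.isSubnormal).2 ⊤ le_top h).symm

theorem IsInjector.eq_of_le {X : Type u} [Group X] [Finite X] {V W : Subgroup X}
    (hV : IsInjector (PiNilpotent π) V) (hVW : V ≤ W) (hW : PiNilpotent π W) : W = V := by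
  have h := (hV ⊤ .top).2 (W.subgroupOf ⊤) (Subgroup.comap_mono hVW)
    (hW.comap (⊤ : Subgroup X).subtype (by rw [Subgroup.ker_subtype]; exact isPiGroup_bot))
  exact le_antisymm (fun x hx => (h.le (show ⟨x, trivial⟩ ∈ W.subgroupOf ⊤ from hx) :)) hVW

/-- V contains the normal π-nilpotent preimage of F, so its image is nilpotent and lies in a Mann
product; maximality of V gives equality with the preimage. -/
theorem IsInjector.exists_isMannFamily {X Y : Type u} [Group X] [Group Y] [Finite X] [Finite Y]
    {F : Subgroup Y} [F.Normal] (hF : Group.IsNilpotent F) (hFπ : IsPiGroup π F)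
    (hC : Subgroup.centralizer (F : Set Y) ≤ F) (f : X →* Y) (hf : Function.Surjective f)
    (hker : IsPiGroup πᶜ f.ker) {V : Subgroup X} (hV : IsInjector (PiNilpotent π) V) :
    ∃ P, IsMannFamily F P ∧ V = (⨆ p, P p).comap f := by
  have hFV : F.comap f ≤ V := by
    refine hV.le_of_normal inferInstance ?_
    exact (hF.piNilpotent.comap f hker).of_injective _ (Subgroup.subtype_injective ⊤)
  have hVπ : PiNilpotent π V := by
    have h1 : PiNilpotent π (V.subgroupOf ⊤) := (hV ⊤ .top).1
    have h2 := PiNilpotent.map h1 (⊤ : Subgroup X).subtype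
    rwa [Subgroup.map_subgroupOf_eq_of_le le_top] at h2
  have hFV' : F ≤ V.map f := by
    rw [← Subgroup.map_comap_eq_self_of_surjective hf F]
    exact Subgroup.map_mono hFV
  have hn := (isNilpotent_of_piNilpotent hFπ hC .top (inf_le_left.trans hFV') le_top
    (hVπ.map f)).1
  obtain ⟨P, hP, hVP⟩ := exists_isMannFamily_of_isNilpotent hn hFV'
  exact ⟨P, hP, (hV.eq_of_le (Subgroup.map_le_iff_le_comap.1 hVP)
    ((hP.isNilpotent_iSup hF hC).piNilpotent.comap f hker)).symm⟩

theorem Subgroup.map_conj_comap {X Y : Type*} [Group X] [Group Y] (f : X →* Y) (g : X)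
    (M : Subgroup Y) : (M.map (MulAut.conj (f g)).toMonoidHom).comap f
      = (M.comap f).map (MulAut.conj g).toMonoidHom := by
  ext x
  constructor
  · rintro ⟨m, hm, hmx⟩
    have : m = f (g⁻¹ * x * g) := by
      simp only [map_mul, map_inv, ← hmx]
      simp [mul_assoc]
    exact ⟨g⁻¹ * x * g, Subgroup.mem_comap.2 (this ▸ hm), by simp [mul_assoc]⟩
  · rintro ⟨v, hv, rfl⟩
    exact ⟨f v, hv, by simp⟩

theorem piRadical_quotient_eq_bot (ρ : Set Nat.Primes) (X : Type u) [Group X] [Finite X]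
    [(piRadical ρ X).Normal] : piRadical ρ (X ⧸ piRadical ρ X) = ⊥ := by
  set R := piRadical ρ X with hR
  have hs := QuotientGroup.mk'_surjective R
  have hn := piRadical_normal ρ (X ⧸ R)
  have h1 : (piRadical ρ (X ⧸ R)).comap (QuotientGroup.mk' R) ≤ R := by
    refine le_piRadical inferInstance (IsPiGroup.of_card_dvd_mul (isPiGroup_piRadical ρ X)
      (isPiGroup_piRadical ρ (X ⧸ R)) (Eq.dvd ?_))
    rw [card_comap_of_surjective _ hs, QuotientGroup.ker_mk']
  rw [← Subgroup.map_comap_eq_self_of_surjective hs (piRadical ρ (X ⧸ R)),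
    Subgroup.map_eq_bot_iff, QuotientGroup.ker_mk']
  exact h1

end Injectors

/-- The first conjunct says that the `π`-nilpotent injectors of `G` form exactly one conjugacy class
of subgroups of `G`. -/
theorem lemma3p1 (π : Set Nat.Primes) (G : Type u) [Group G] [Finite G] (hG : IsPiSoluble π G) :
    (∃ V : Subgroup G, ∀ W : Subgroup G,
      IsInjector (PiNilpotent π) W ↔ ∃ g : G, W = V.map (MulAut.conj g).toMonoidHom) ∧
    (∀ V : Subgroup G, IsInjector (PiNilpotent π) V →
      ∃ H : Subgroup G, IsHallSubgroup π H ∧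
        ∃ L : Subgroup H, IsInjector (NilpotentPi π) L ∧
          (V : Set G) = (piRadical πᶜ G : Set G) * (L.map H.subtype : Set G)) := by
  have hRn := piRadical_normal πᶜ G
  set R := piRadical πᶜ G with hR
  have hRπ : IsPiGroup πᶜ R := isPiGroup_piRadical πᶜ G
  set f := QuotientGroup.mk' R with hfdef
  have hf : Function.Surjective f := QuotientGroup.mk'_surjective R
  have hfk : f.ker = R := QuotientGroup.ker_mk' R
  have hker : IsPiGroup πᶜ f.ker := by rwa [hfk]
  have hser := hG.hasPiSeries
  obtain ⟨F, hFn, hF, hFπ, hC⟩ := (hser.of_surjective f hf).exists_centralizer_le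
    (piRadical_quotient_eq_bot πᶜ G)
  obtain ⟨H₀, hH₀⟩ := hser.exists_isHallSubgroup
  obtain ⟨P, hP, hPH⟩ := (hH₀.map f hf).exists_isMannFamily hFπ hC
  refine ⟨⟨(⨆ p, P p).comap f, fun W => ⟨fun hW => ?_, ?_⟩⟩, fun V hV => ?_⟩
  · obtain ⟨Q, hQ, rfl⟩ := hW.exists_isMannFamily hF hFπ hC f hf hker
    obtain ⟨y, hy⟩ := hP.exists_conj hQ hF hC
    obtain ⟨g, rfl⟩ := hf y
    exact ⟨g, by rw [hy, Subgroup.map_conj_comap]⟩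
  · rintro ⟨g, rfl⟩
    rw [← Subgroup.map_conj_comap, Subgroup.map_iSup]
    exact (hP.conj (f g)).isInjector_comap hF hFπ hC f hf hker
  · obtain ⟨Q, hQ, rfl⟩ := hV.exists_isMannFamily hF hFπ hC f hf hker
    obtain ⟨y, hy⟩ := hP.exists_conj hQ hF hC
    obtain ⟨g, rfl⟩ := hf y
    have hPg := hP.conj (f g)
    rw [Subgroup.map_iSup] at hy
    -- The conjugator taking the family inside the image of H₀ to the one defining V also moves H₀.
    set H := H₀.map (MulAut.conj g).toMonoidHom with hHdef
    have hH : IsHallSubgroup π H := hH₀.map _ (MulAut.conj g).surjective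
    set φ := f.comp H.subtype with hφ
    have hφr : φ.range = H.map f := by
      rw [hφ, MonoidHom.range_comp, Subgroup.range_subtype]
    -- H ∩ R = 1 by coprime orders.
    have hφi : Function.Injective φ := by
      rw [← MonoidHom.ker_eq_bot_iff, Subgroup.eq_bot_iff_forall]
      intro x hx
      have hxR : (x : G) ∈ R := (QuotientGroup.eq_one_iff _).1 (MonoidHom.mem_ker.1 hx)
      refine orderOf_eq_one_iff.1 (Nat.eq_one_of_dvd_coprimes (hH.1.coprime_card hRπ)
        (orderOf_dvd_natCard x) ?_)
      rw [← Subgroup.orderOf_coe]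
      exact Subgroup.orderOf_dvd_natCard _ hxR
    have hFφ : F ≤ φ.range := hφr ▸ (hH.map f hf).le_of_normal hFπ
    have hPφ : ∀ p, (P p).map (MulAut.conj (f g)).toMonoidHom ≤ φ.range := by
      intro p
      rintro _ ⟨y, hy', rfl⟩
      obtain ⟨x, hx, rfl⟩ := hPH p hy'
      exact ⟨⟨g * x * g⁻¹, ⟨x, hx, rfl⟩⟩, by simp [hφ]⟩
    have hfam := hPg.comap φ hφi hFφ hPφ
    have hFφn : Group.IsNilpotent (F.comap φ) := Subgroup.isNilpotent_comap_of_injective φ hφi hF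
    have hCφ : Subgroup.centralizer (F.comap φ : Set H) ≤ F.comap φ := by
      intro x hx
      refine hC (Subgroup.mem_centralizer_iff.2 fun a ha => ?_)
      obtain ⟨b, rfl⟩ := hFφ ha
      rw [← map_mul, ← map_mul, Subgroup.mem_centralizer_iff.1 hx b ha]
    have hinj := hfam.isInjector_nilpotentPi hH.1 hFφn hCφ
    rw [Subgroup.iSup_comap_of_injective φ hφi hPφ, ← hy] at hinj
    refine ⟨H, hH, (⨆ p, Q p).comap φ, hinj, Set.Subset.antisymm ?_ ?_⟩
    · intro v hv
      have hvr : f v ∈ φ.range := by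
        have hle : ⨆ p, Q p ≤ φ.range := hy ▸ iSup_le hPφ
        exact hle hv
      obtain ⟨x, hx⟩ := hvr
      -- As f v = f x with x ∈ H, the quotient v x⁻¹ lies in ker f = R.
      refine ⟨v * (x : G)⁻¹, ?_, x, ⟨x, ?_, rfl⟩, by simp⟩
      · rw [SetLike.mem_coe, ← hfk, MonoidHom.mem_ker, map_mul, map_inv, ← hx]
        simp [hφ]
      · rw [SetLike.mem_coe, Subgroup.mem_comap, hx]
        exact hv
    · rintro _ ⟨r, hr, _, ⟨x, hx, rfl⟩, rfl⟩
      have hr1 : f r = 1 := by rw [← MonoidHom.mem_ker, hfk]; exact hr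
      have : f (r * (x : G)) = φ x := by rw [map_mul, hr1, one_mul]; rfl
      exact (Subgroup.mem_comap.2 (this.symm ▸ hx) : r * (x : G) ∈ (⨆ p, Q p).comap f)
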